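/- Let $\alpha>0$, $\delta>-1$ and $m=1$. **The graph sequence.** $G_1$ is a single vertex $v_1$ carrying a half-edge. Given $G_1,\dots,G_n$, a graph on $\{v_1,\dots,v_n\}$, the graph $G_{n+1}$ is obtained from $G_n$ by adding a vertex $v_{n+1}$ and one edge joining it to exactly one old vertex, which is $v_i$ with conditional probability $$\frac{(\delta+d_i(n))^{-\alpha}}{\sum_{j=1}^n(\delta+d_j(n))^{-\alpha}},\qquad 1\le i\le n,$$ where $d_i(n)$ is the degree of $v_i$ in $G_n$, the half-edge counting as one in the degree of $v_1$. **The branching tree.** Let $\{\xi(t):t\ge 0\}$ be a pure birth process, that is, a time-homogeneous $\mathbb N$-valued Markov process with nondecreasing right-continuous paths, with $\xi(0)=1$ almost surely and, as $h\downarrow0$, for $k\ge1$, $$P(\xi(t+h)=k+1\mid \xi(t)=k)=\frac{h}{(k+\delta)^{\alpha}}+o(h),\qquad P(\xi(t+h)=k\mid \xi(t)=k)=1-\frac{h}{(k+\delta)^{\alpha}}+o(h).$$ Start with one individual (the root) at time $0$. Every individual $x$ has its own independent copy $\xi_x$ of $\xi$, and has had $\xi_x(t)-1$ children when its age is $t$.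 Let $\Upsilon(t)$ be the tree of all individuals born up to time $t$, with edges joining parents and children, and put $\tau_1=0$ and $\tau_n=\inf\{t\ge\tau_{n-1}:|\Upsilon(t)|=n\}$ for $n\ge2$. **Theorem.** Almost surely, for every $n\ge2$, $\tau_n<\infty$, $|\Upsilon(\tau_n)|=n$, and the individuals of $\Upsilon(\tau_n)$ have distinct birth times. If the vertices of $\Upsilon(\tau_n)$ are labelled $v_1,\dots,v_n$ in the order of birth, then the sequences of random graphs $\{G_n\}_{n=2}^\infty$ and $\{\Upsilon(\tau_n)\}_{n=2}^\infty$ have the same (joint) law. -/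

import Mathlib

open MeasureTheory ProbabilityTheory Filter Topology Asymptotics
open scoped ENNReal NNReal

namespace DePref

/-! ### The inverse de-preferential attachment graph sequence, one edge per new vertex -/

/-- Degree of the vertex `i` of `g`. The vertex `0` (the oldest one, the root) carries an additional
half edge, which counts in its degree. -/
noncomputable def degree {n : ℕ} (g : SimpleGraph (Fin n)) (i : Fin n) : ℕ :=
  (g.neighborSet i).ncard + if (i : ℕ) = 0 then 1 else 0

/-- The graph on `n + 1` vertices in which a new vertex `n` is joined to the old vertex `i`. -/
def attach {n : ℕ} (g : SimpleGraph (Fin n)) (i : Fin n) : SimpleGraph (Fin (n + 1)) :=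
  g.map Fin.castSuccEmb ⊔ SimpleGraph.edge i.castSucc (Fin.last n)

/-- The σ-algebra generated by the graphs `G 0, …, G n`. -/
abbrev graphHistory {Ω : Type*} (G : (n : ℕ) → Ω → SimpleGraph (Fin n)) (n : ℕ) :
    MeasurableSpace Ω :=
  ⨆ k ≤ n, MeasurableSpace.comap (G k) inferInstance

/-- `G n` is a random graph with `n` vertices, the vertex `i : Fin n` being the `(i+1)`-st to arrive.
Given the past, the vertex that arrives next is joined to exactly one old vertex `i`, with
probability `C / (δ + d_i) ^ α`, where `1 / C = ∑ j, 1 / (δ + d_j) ^ α`. There is only one graph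
with one vertex, so that no initial condition is needed. -/
structure IsInverseDePreferential {Ω : Type*} [MeasurableSpace Ω] (P : Measure Ω) (α δ : ℝ)
    (G : (n : ℕ) → Ω → SimpleGraph (Fin n)) : Prop where
  measurable : ∀ n, Measurable (G n)
  step : ∀ (n : ℕ) (i : Fin n),
    P⟦{ω | G (n + 1) ω = attach (G n ω) i} | graphHistory G n⟧ =ᵐ[P] fun ω =>
      (1 / (δ + degree (G n ω) i) ^ α) / ∑ j : Fin n, 1 / (δ + degree (G n ω) j) ^ α

/-! ### Pure birth processes -/

/-- `X` is a pure birth process started at `k₀`, with birth rate `rate k` in the state `k`: a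
time-homogeneous Markov process with values in `ℕ`, with nondecreasing right-continuous paths and
with transition probabilities `p k j h = P (X (s + h) = j | X s = k)` that satisfy, as `h ↓ 0`,
`p k (k + 1) h = rate k * h + o(h)` and `p k k h = 1 - rate k * h + o(h)`. -/
structure IsPureBirthProcess {Ω : Type*} [MeasurableSpace Ω] (P : Measure Ω) (k₀ : ℕ)
    (rate : ℕ → ℝ) (X : ℝ≥0 → Ω → ℕ) : Prop where
  measurable : ∀ t, Measurable (X t)
  initial : ∀ᵐ ω ∂P, X 0 ω = k₀
  monotone : ∀ᵐ ω ∂P, Monotone fun t => X t ω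
  rightContinuous : ∀ᵐ ω ∂P, ∀ t, ContinuousWithinAt (fun s => X s ω) (Set.Ici t) t
  markov : ∃ p : ℕ → ℕ → ℝ≥0 → ℝ,
    (∀ (s h : ℝ≥0) (k j : ℕ) (A : Set Ω),
      MeasurableSet[⨆ u ≤ s, MeasurableSpace.comap (X u) inferInstance] A →
        P.real (A ∩ {ω | X s ω = k} ∩ {ω | X (s + h) ω = j})
          = P.real (A ∩ {ω | X s ω = k}) * p k j h) ∧
    (∀ k, k₀ ≤ k →
      (fun h : ℝ≥0 => p k (k + 1) h - rate k * h) =o[𝓝[>] 0] fun h : ℝ≥0 => (h : ℝ)) ∧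
    (∀ k, k₀ ≤ k →
      (fun h : ℝ≥0 => p k k h - (1 - rate k * h)) =o[𝓝[>] 0] fun h : ℝ≥0 => (h : ℝ))

/-! ### The branching tree

Individuals carry Ulam–Harris labels, written in reverse: `[]` is the root, and `j :: x` is the
`(j+1)`-st child of the individual `x`. The individual `x` reproduces according to the process
`ξ x`, run in the age of `x`: at the age `t` it has had `ξ x t - 1` children. -/

/-- The age at which the individual with reproduction path `X` bears its `(j+1)`-st child (`∞` if
it never does). -/
noncomputable def childAge (X : ℝ≥0 → ℕ) (j : ℕ) : ℝ≥0∞ :=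
  ⨅ (t : ℝ≥0) (_ : j + 2 ≤ X t), (t : ℝ≥0∞)

/-- The birth times of all the individuals, for given reproduction paths. -/
noncomputable def birthTime (X : List ℕ → ℝ≥0 → ℕ) : List ℕ → ℝ≥0∞
  | [] => 0
  | j :: x => birthTime X x + childAge (X x) j

/-- The tree at time `t`: the set of the individuals born up to time `t`. -/
def tree (X : List ℕ → ℝ≥0 → ℕ) (t : ℝ≥0∞) : Set (List ℕ) :=
  {x | birthTime X x ≤ t}

/-- The time `τ n` at which the tree reaches the size `n`. It starts with one individual, at
`τ 1 = 0`, and `τ n` is the infimum of the times `t ≥ τ (n - 1)` with `n` individuals. -/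
noncomputable def hittingTime (X : List ℕ → ℝ≥0 → ℕ) : ℕ → ℝ≥0∞
  | 0 => 0
  | 1 => 0
  | n + 2 => ⨅ (t : ℝ≥0) (_ : hittingTime X (n + 1) ≤ t ∧ (tree X t).encard = ((n + 2 : ℕ) : ℕ∞)),
      (t : ℝ≥0∞)

/-- The individual `x` is the `(i+1)`-st to be born: exactly `i` individuals were born before. -/
def HasBirthRank (X : List ℕ → ℝ≥0 → ℕ) (x : List ℕ) (i : ℕ) : Prop :=
  {y | birthTime X y < birthTime X x}.encard = (i : ℕ∞)

/-- `y` is a child of `x`. -/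
def IsChild (x y : List ℕ) : Prop := ∃ j, y = j :: x

/-- The tree at the time `τ n`, as a graph on `Fin n`: the vertices are the individuals, in the order
of their births, and the edges join parents and children. -/
noncomputable def treeGraph (X : List ℕ → ℝ≥0 → ℕ) (n : ℕ) : SimpleGraph (Fin n) :=
  SimpleGraph.fromRel fun a b => ∃ x ∈ tree X (hittingTime X n), ∃ y ∈ tree X (hittingTime X n),
    HasBirthRank X x a ∧ HasBirthRank X y b ∧ IsChild x y

end DePref

namespace DePref

/-! ### Passage times of a nondecreasing right-continuous path -/

/-! Attach to each birth a clock: for `j :: x` it is the time that the path of `x` spends in the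
state `j + 1`. Suppose that these clocks are independent and exponential with rates `1 / ((j + 1) +
δ) ^ α`. When `n` individuals are alive, exactly one clock per individual is running, that of its
next child. By memorylessness the residual clocks are again independent and exponential, so the next
parent is chosen with probability proportional to the rate of its running clock. An individual with
`c` children has degree `c + 1` (the half edge stands in for the missing parent of the root), and
its running clock has rate `1 / ((c + 1) + δ) ^ α`. This is the attachment rule.

The exponential clocks have to be extracted from the infinitesimal description of the process.
Discretising time gives a strong Markov property at passage times (`measure_inter_reachTime`): a
sojourn is independent of the past, and its survival function is a diagonal transition probability,
which is multiplicative and hence exponential (`eq_exp_of_add_eq_mul`). A union bound over a fine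
grid excludes jumps of size two or more (`ae_reachTime_lt_succ`). The outcome is
`iIndepFun_holdTime` for one path and `indepExp_birthClock` for the whole family.

The race between clocks is computed in `measure_ringsFirst_inter_aux`. Iterating it along a fixed
order of births yields `cond_realizes` and `measure_realizes_succ`; the continuations of an order
exhaust its probability, so almost surely some order without ties is realized
(`ae_exists_realizes`), and it determines the tree graphs. Different orders may give the same
graphs, but the next choice depends on the order only through the graph (`attachProb_eq`). Summing
over orders (`measure_cylinder_treeGraph_inter`) gives the one-step probabilities of the attachment
sequence, and these determine the law (`measure_cylinder_eq`, `identDistrib_of_measure_cylinder`).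
-/

/-- The time at which the path `f` exceeds `k`, read off along a countable dense set of times. -/
noncomputable def reachTime (f : ℝ≥0 → ℕ) (k : ℕ) : ℝ≥0∞ :=
  ⨅ n : ℕ, if k + 1 ≤ f (TopologicalSpace.denseSeq ℝ≥0 n) then
    (TopologicalSpace.denseSeq ℝ≥0 n : ℝ≥0∞) else ⊤

lemma measurable_reachTime (k : ℕ) : Measurable fun f : ℝ≥0 → ℕ => reachTime f k := by
  unfold reachTime
  refine Measurable.iInf fun n => Measurable.ite ?_ measurable_const measurable_const
  exact measurableSet_le measurable_const (measurable_pi_apply _)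

/-- A nondecreasing right-continuous path started at `1`. -/
structure IsCountingPath (f : ℝ≥0 → ℕ) : Prop where
  zero : f 0 = 1
  mono : Monotone f
  rightContinuous : ∀ t, ContinuousWithinAt f (Set.Ici t) t

namespace IsCountingPath

variable {f : ℝ≥0 → ℕ} (hf : IsCountingPath f)
include hf

lemma exists_constant_right (t : ℝ≥0) : ∃ u, t < u ∧ ∀ s, t ≤ s → s < u → f s = f t := by
  have h : ∀ᶠ s in 𝓝[≥] t, f s = f t := by
    exact (hf.rightContinuous t).eventually (isOpen_discrete {f t} |>.mem_nhds rfl)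
  obtain ⟨u, hu, hu'⟩ := (mem_nhdsGE_iff_exists_Ico_subset).1 h
  exact ⟨u, hu, fun s hs hsu => hu' ⟨hs, hsu⟩⟩

/-- Right continuity with integer values keeps the path constant for a while after `t`, so a level
not reached at `t` is reached strictly later. This is why the infimum over a countable dense set,
chosen for measurability, loses nothing. -/
lemma reachTime_le_iff (k : ℕ) (t : ℝ≥0) : reachTime f k ≤ t ↔ k + 1 ≤ f t := by
  constructor
  · intro h
    by_contra hk
    obtain ⟨u, htu, hu⟩ := hf.exists_constant_right t
    have : (u : ℝ≥0∞) ≤ reachTime f k := by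
      refine le_iInf fun n => ?_
      split_ifs with hn
      · rw [ENNReal.coe_le_coe]
        by_contra hlt
        push Not at hlt hk
        rcases le_total t (TopologicalSpace.denseSeq ℝ≥0 n) with h1 | h1
        · rw [hu _ h1 hlt] at hn; omega
        · have := hf.mono h1; omega
      · exact le_top
    have := this.trans h
    rw [ENNReal.coe_le_coe] at this
    exact absurd this (not_le.2 htu)
  · intro h
    refine le_of_forall_gt_imp_ge_of_dense fun c hc => ?_
    obtain ⟨r, hr, hrc⟩ := ENNReal.lt_iff_exists_nnreal_btwn.1 hc
    rw [ENNReal.coe_lt_coe] at hr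
    obtain ⟨_, ⟨h1, h2⟩, n, rfl⟩ :=
      (TopologicalSpace.denseRange_denseSeq ℝ≥0).inter_open_nonempty _ isOpen_Ioo
        (Set.nonempty_Ioo.2 hr)
    refine (iInf_le _ n).trans ?_
    rw [if_pos (h.trans (hf.mono h1.le))]
    exact (ENNReal.coe_lt_coe.2 h2).le.trans hrc.le

lemma lt_reachTime_iff (k : ℕ) (t : ℝ≥0) : (t : ℝ≥0∞) < reachTime f k ↔ f t < k + 1 := by
  rw [← not_le, hf.reachTime_le_iff, not_le]

lemma childAge_eq (j : ℕ) : childAge f j = reachTime f (j + 1) := by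
  refine le_antisymm (le_iInf fun n => ?_) (le_iInf₂ fun t ht => ?_)
  · split_ifs with h
    · exact iInf₂_le_of_le _ h le_rfl
    · exact le_top
  · exact (hf.reachTime_le_iff _ _).2 ht

lemma reachTime_zero : reachTime f 0 = 0 := by
  have := (hf.reachTime_le_iff 0 0).2 (by rw [hf.zero])
  simpa using this

end IsCountingPath

/-! ### The strong Markov property of a pure birth process at its passage times -/

section PureBirth

variable {Ω : Type*} [mΩ : MeasurableSpace Ω] {P : Measure Ω} {rate : ℕ → ℝ}
  {X : ℝ≥0 → Ω → ℕ}

/-- The σ-algebra generated by the process up to the time `s`. -/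
abbrev pathHistory (X : ℝ≥0 → Ω → ℕ) (s : ℝ≥0) : MeasurableSpace Ω :=
  ⨆ u ≤ s, MeasurableSpace.comap (X u) inferInstance

omit mΩ in
lemma measurable_pathHistory {u s : ℝ≥0} (h : u ≤ s) : Measurable[pathHistory X s] (X u) :=
  Measurable.mono (comap_measurable (X u))
    (le_iSup₂ (f := fun u (_ : u ≤ s) => MeasurableSpace.comap (X u) inferInstance) u h) le_rfl

lemma IsPureBirthProcess.pathHistory_le {k₀ : ℕ} (hX : IsPureBirthProcess P k₀ rate X) (s : ℝ≥0) :
    pathHistory X s ≤ mΩ :=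
  iSup₂_le fun u _ => (hX.measurable u).comap_le

lemma IsPureBirthProcess.ae_isCountingPath (hX : IsPureBirthProcess P 1 rate X) :
    ∀ᵐ ω ∂P, IsCountingPath fun t => X t ω := by
  filter_upwards [hX.initial, hX.monotone, hX.rightContinuous] with ω h1 h2 h3
  exact ⟨h1, h2, h3⟩

/-- The events observed, up to null sets, before the process exceeds `k`. -/
@[reducible]
def stoppedHistory (P : Measure Ω) (X : ℝ≥0 → Ω → ℕ) (k : ℕ) : MeasurableSpace Ω where
  MeasurableSet' A := MeasurableSet A ∧
    ∀ s, ∃ B, MeasurableSet[pathHistory X s] B ∧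
      ∀ᵐ ω ∂P, (ω ∈ A ∧ k + 1 ≤ X s ω) ↔ ω ∈ B
  measurableSet_empty := ⟨.empty, fun s => ⟨∅, MeasurableSpace.measurableSet_empty _, by simp⟩⟩
  measurableSet_compl A hA := by
    refine ⟨hA.1.compl, fun s => ?_⟩
    obtain ⟨B, hB, hAB⟩ := hA.2 s
    have hs : MeasurableSet[pathHistory X s] {ω | k + 1 ≤ X s ω} :=
      measurable_pathHistory le_rfl (MeasurableSet.of_discrete (s := {n | k + 1 ≤ n}))
    -- Complements are taken inside the event that the level has been exceeded by time `s`.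
    refine ⟨{ω | k + 1 ≤ X s ω} \ B, @MeasurableSet.diff _ (pathHistory X s) _ _ hs hB, ?_⟩
    filter_upwards [hAB] with ω h
    change (¬ (ω ∈ A) ∧ _) ↔ (k + 1 ≤ X s ω ∧ ¬ (ω ∈ B))
    rw [← h]
    tauto
  measurableSet_iUnion A hA := by
    refine ⟨.iUnion fun i => (hA i).1, fun s => ?_⟩
    choose B hB hAB using fun i => (hA i).2 s
    refine ⟨⋃ i, B i, @MeasurableSet.iUnion _ _ (pathHistory X s) _ _ hB, ?_⟩
    filter_upwards [ae_all_iff.2 hAB] with ω h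
    simp only [Set.mem_iUnion, ← h, exists_and_right]

lemma stoppedHistory_le (k : ℕ) : stoppedHistory P X k ≤ mΩ := fun _ hA => hA.1

lemma measurable_reachTime_path (hX : ∀ t, Measurable (X t)) (k : ℕ) :
    Measurable fun ω => reachTime (fun t => X t ω) k :=
  (measurable_reachTime k).comp (measurable_pi_iff.2 hX)

/-- Once the level `k` has been exceeded by time `s`, so has the level `i ≤ k`. Hence only times up
to `min a s` need to be inspected: for `s ≤ a` the condition on `i` is automatic. -/
lemma IsPureBirthProcess.measurable_reachTime_stoppedHistory
    (hX : IsPureBirthProcess P 1 rate X) {i k : ℕ} (hik : i ≤ k) :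
    Measurable[stoppedHistory P X k] fun ω => reachTime (fun t => X t ω) i := by
  refine @measurable_of_Iic _ _ _ _ _ (stoppedHistory P X k) _ _ _ _ fun a => ?_
  refine ⟨measurable_reachTime_path hX.measurable i measurableSet_Iic, fun s => ?_⟩
  have hs : MeasurableSet[pathHistory X s] {ω | k + 1 ≤ X s ω} :=
    measurable_pathHistory le_rfl (MeasurableSet.of_discrete (s := {n | k + 1 ≤ n}))
  induction a with
  | top => exact ⟨{ω | k + 1 ≤ X s ω}, hs, by simp⟩
  | coe a =>
    have ha : MeasurableSet[pathHistory X s] {ω | i + 1 ≤ X (min a s) ω} :=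
      measurable_pathHistory (min_le_right _ _) (MeasurableSet.of_discrete (s := {n | i + 1 ≤ n}))
    refine ⟨{ω | i + 1 ≤ X (min a s) ω} ∩ {ω | k + 1 ≤ X s ω},
      @MeasurableSet.inter _ (pathHistory X s) _ _ ha hs, ?_⟩
    filter_upwards [hX.ae_isCountingPath] with ω hω
    have := hω.reachTime_le_iff i a
    change (reachTime (fun t => X t ω) i ≤ a ∧ k + 1 ≤ X s ω) ↔
      (i + 1 ≤ X (min a s) ω ∧ k + 1 ≤ X s ω)
    rw [this]
    rcases le_total a s with h | h
    · rw [min_eq_left h]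
    · rw [min_eq_right h]
      have : X s ω ≤ X a ω := hω.mono h
      constructor <;> rintro ⟨h1, h2⟩ <;> exact ⟨by omega, h2⟩

/-- `p` is the transition function of `X`. -/
def IsTransition (P : Measure Ω) (X : ℝ≥0 → Ω → ℕ) (p : ℕ → ℕ → ℝ≥0 → ℝ) : Prop :=
  ∀ (s h : ℝ≥0) (k j : ℕ) (A : Set Ω), MeasurableSet[pathHistory X s] A →
    P.real (A ∩ {ω | X s ω = k} ∩ {ω | X (s + h) ω = j})
      = P.real (A ∩ {ω | X s ω = k}) * p k j h

/-- The first point `m * h` of a grid at which `X` exceeds `k`. -/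
def firstGrid (X : ℝ≥0 → Ω → ℕ) (k : ℕ) (h : ℝ≥0) (m : ℕ) : Set Ω :=
  {ω | (∀ l < m, X (l * h) ω < k + 1) ∧ k + 1 ≤ X (m * h) ω}

omit mΩ in
lemma measurableSet_firstGrid (k : ℕ) (h : ℝ≥0) (m : ℕ) :
    MeasurableSet[pathHistory X (m * h)] (firstGrid X k h m) := by
  have h1 : ∀ l < m, MeasurableSet[pathHistory X (m * h)] {ω | X (l * h) ω < k + 1} := by
    intro l hl
    refine measurable_pathHistory ?_ (MeasurableSet.of_discrete (s := {n | n < k + 1}))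
    gcongr
  have h2 : MeasurableSet[pathHistory X (m * h)] {ω | k + 1 ≤ X (m * h) ω} :=
    measurable_pathHistory le_rfl (MeasurableSet.of_discrete (s := {n | k + 1 ≤ n}))
  have : firstGrid X k h m = (⋂ l ∈ Set.Iio m, {ω | X (l * h) ω < k + 1}) ∩
      {ω | k + 1 ≤ X (m * h) ω} := by
    ext ω; simp [firstGrid]
  rw [this]
  refine @MeasurableSet.inter _ (pathHistory X (m * h)) _ _ ?_ h2
  exact @MeasurableSet.biInter _ _ (pathHistory X (m * h)) _ _ (Set.to_countable _) h1

omit mΩ in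
lemma disjoint_firstGrid (k : ℕ) (h : ℝ≥0) :
    Pairwise (Function.onFun Disjoint (firstGrid X k h)) := by
  have key : ∀ i j, i < j → Disjoint (firstGrid X k h i) (firstGrid X k h j) := by
    intro i j hij
    refine Set.disjoint_left.2 fun ω h1 h2 => ?_
    have := h2.1 i hij
    have := h1.2
    omega
  intro i j hij
  rcases lt_or_gt_of_ne hij with h' | h'
  · exact key i j h'
  · exact (key j i h').symm

/-- `X` is in the state `k + 1` at the first grid point at which it exceeds `k`, and at the time
`a` after it. -/
def gridStay (X : ℝ≥0 → Ω → ℕ) (k : ℕ) (h a : ℝ≥0) : Set Ω :=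
  ⋃ m : ℕ, firstGrid X k h m ∩ {ω | X (m * h) ω = k + 1} ∩ {ω | X (m * h + a) ω = k + 1}

lemma IsPureBirthProcess.measurableSet_firstGrid (hX : IsPureBirthProcess P 1 rate X)
    (k : ℕ) (h : ℝ≥0) (m : ℕ) : MeasurableSet (firstGrid X k h m) :=
  hX.pathHistory_le _ _ (DePref.measurableSet_firstGrid k h m)

lemma measurableSet_state (hX : ∀ t, Measurable (X t)) (t : ℝ≥0) (k : ℕ) :
    MeasurableSet {ω | X t ω = k} :=
  hX t (MeasurableSet.of_discrete (s := {k}))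

lemma IsPureBirthProcess.measurableSet_gridStay (hX : IsPureBirthProcess P 1 rate X)
    (k : ℕ) (h a : ℝ≥0) : MeasurableSet (gridStay X k h a) :=
  .iUnion fun m => ((hX.measurableSet_firstGrid k h m).inter
    (measurableSet_state hX.measurable _ _)).inter (measurableSet_state hX.measurable _ _)

lemma IsTransition.measure_eq [IsFiniteMeasure P] {p : ℕ → ℕ → ℝ≥0 → ℝ} (hp : IsTransition P X p)
    {s : ℝ≥0} (h : ℝ≥0) (k j : ℕ) {A : Set Ω} (hA : MeasurableSet[pathHistory X s] A) :
    P (A ∩ {ω | X s ω = k} ∩ {ω | X (s + h) ω = j})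
      = P (A ∩ {ω | X s ω = k}) * ENNReal.ofReal (p k j h) := by
  rw [← ENNReal.ofReal_toReal (measure_ne_top P (A ∩ {ω | X s ω = k} ∩ _)),
    ← ENNReal.ofReal_toReal (measure_ne_top P (A ∩ {ω | X s ω = k})),
    ← ENNReal.ofReal_mul ENNReal.toReal_nonneg]
  exact congrArg _ (hp s h k j A hA)

/-- On the event that `m * h` is the first grid point past the level, `A` agrees almost surely with
an event of the history up to `m * h`. The ordinary Markov property applies there, and the disjoint
contributions are summed over `m`. -/
lemma IsPureBirthProcess.measure_inter_gridStay [IsFiniteMeasure P]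
    (hX : IsPureBirthProcess P 1 rate X)
    {p : ℕ → ℕ → ℝ≥0 → ℝ} (hp : IsTransition P X p) {k : ℕ} {A : Set Ω}
    (hA : MeasurableSet[stoppedHistory P X k] A) (h a : ℝ≥0) :
    P (A ∩ gridStay X k h a)
      = P (A ∩ gridStay X k h 0) * ENNReal.ofReal (p (k + 1) (k + 1) a) := by
  have h0 : gridStay X k h 0 = ⋃ m : ℕ, firstGrid X k h m ∩ {ω | X (m * h) ω = k + 1} := by
    simp [gridStay, Set.inter_assoc]
  have hd := disjoint_firstGrid (X := X) k h
  rw [h0, gridStay, Set.inter_iUnion, Set.inter_iUnion, measure_iUnion, measure_iUnion,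
    ← ENNReal.tsum_mul_right]
  · refine tsum_congr fun m => ?_
    obtain ⟨B, hB, hAB⟩ := hA.2 (m * h)
    have e : (A ∩ (firstGrid X k h m ∩ {ω | X (m * h) ω = k + 1}) : Set Ω) =ᵐ[P]
        ((B ∩ firstGrid X k h m) ∩ {ω | X (m * h) ω = k + 1} : Set Ω) := by
      refine eventuallyEq_set.2 ?_
      filter_upwards [hAB] with ω hω
      simp only [Set.mem_inter_iff, ← hω]
      constructor
      · rintro ⟨h1, h2, h3⟩
        exact ⟨⟨⟨h1, h2.2⟩, h2⟩, h3⟩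
      · rintro ⟨⟨⟨h1, -⟩, h2⟩, h3⟩
        exact ⟨h1, h2, h3⟩
    have e' := e.inter (ae_eq_refl ({ω | X (m * h + a) ω = k + 1} : Set Ω))
    rw [← Set.inter_assoc, measure_congr e', measure_congr e]
    exact hp.measure_eq a (k + 1) (k + 1)
      (@MeasurableSet.inter _ (pathHistory X (m * h)) _ _ hB (DePref.measurableSet_firstGrid k h m))
  · exact fun i j hij => (hd hij).mono (fun ω hω => hω.2.1) (fun ω hω => hω.2.1)
  · exact fun m => hA.1.inter ((hX.measurableSet_firstGrid k h m).inter
      (measurableSet_state hX.measurable _ _))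
  · exact fun i j hij => (hd hij).mono (fun ω hω => hω.2.1.1) (fun ω hω => hω.2.1.1)
  · exact fun m => hA.1.inter (((hX.measurableSet_firstGrid k h m).inter
      (measurableSet_state hX.measurable _ _)).inter (measurableSet_state hX.measurable _ _))

-- If the sojourn is longer than `a`, the first grid point after the passage is late by less than
-- the mesh, and a mesh below the remaining slack puts it and its translate by `a` inside the
-- sojourn. Conversely, a grid point that witnesses membership forces the inequality for every mesh.
omit mΩ in
lemma IsCountingPath.eventually_mem_gridStay_iff {k : ℕ} {a : ℝ≥0} {ω : Ω}
    (hω : IsCountingPath fun t => X t ω) :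
    ∀ᶠ N : ℕ in atTop, ω ∈ gridStay X k (1 / ((N : ℝ≥0) + 1)) a ↔
      reachTime (fun t => X t ω) k + a < reachTime (fun t => X t ω) (k + 1) := by
  by_cases hlt : reachTime (fun t => X t ω) k + a < reachTime (fun t => X t ω) (k + 1)
  · have htop : reachTime (fun t => X t ω) k ≠ ⊤ := fun h => by simp [h] at hlt
    lift reachTime (fun t => X t ω) k to ℝ≥0 using htop with t ht
    obtain ⟨r, hr, hr'⟩ := ENNReal.lt_iff_exists_nnreal_btwn.1 hlt
    have hr : t + a < r := by exact_mod_cast hr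
    have hN : ∀ᶠ N : ℕ in atTop, 1 / ((N : ℝ≥0) + 1) < r - (t + a) :=
      (tendsto_one_div_add_atTop_nhds_zero_nat (𝕜 := ℝ≥0)).eventually_lt_const (tsub_pos_of_lt hr)
    filter_upwards [hN] with N hN
    refine iff_of_true ?_ hlt
    set h : ℝ≥0 := 1 / ((N : ℝ≥0) + 1) with hh
    have hpos : 0 < h := by positivity
    have hm1 : t ≤ ⌈t / h⌉₊ * h := by
      rw [← div_le_iff₀ hpos]; exact Nat.le_ceil _
    have hm2 : ⌈t / h⌉₊ * h < t + h := by
      have := Nat.ceil_lt_add_one (a := t / h) (by positivity)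
      calc ⌈t / h⌉₊ * h < (t / h + 1) * h := by gcongr
        _ = t + h := by field_simp
    have hm3 : ⌈t / h⌉₊ * h + a < r := by
      calc ⌈t / h⌉₊ * h + a < t + h + a := by gcongr
        _ = h + (t + a) := by ring
        _ ≤ r := (lt_tsub_iff_right.1 hN).le
    have e1 : k + 1 ≤ X (⌈t / h⌉₊ * h) ω := by
      refine (hω.reachTime_le_iff k _).1 ?_
      rw [← ht]; exact_mod_cast hm1
    have e2 : X (⌈t / h⌉₊ * h + a) ω < k + 1 + 1 := by
      refine (hω.lt_reachTime_iff (k + 1) _).1 (lt_trans ?_ hr')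
      exact_mod_cast hm3
    have e3 := hω.mono (le_self_add : ⌈t / h⌉₊ * h ≤ ⌈t / h⌉₊ * h + a)
    -- The first multiple of `h` that is at least the passage time `t`.
    refine Set.mem_iUnion.2 ⟨⌈t / h⌉₊, ⟨⟨fun l hl => ?_, e1⟩, ?_⟩, ?_⟩
    · refine (hω.lt_reachTime_iff k _).1 ?_
      rw [← ht]
      have := Nat.lt_ceil.1 hl
      rw [lt_div_iff₀ hpos] at this
      exact_mod_cast this
    · change X (⌈t / h⌉₊ * h) ω = k + 1
      omega
    · change X (⌈t / h⌉₊ * h + a) ω = k + 1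
      omega
  · refine Eventually.of_forall fun N => iff_of_false ?_ hlt
    intro hmem
    obtain ⟨m, ⟨⟨-, h1⟩, -⟩, h3⟩ := Set.mem_iUnion.1 hmem
    change X _ ω = k + 1 at h3
    have h1' := (hω.reachTime_le_iff k _).2 h1
    have h3' := (hω.lt_reachTime_iff (k + 1) _).2 (by rw [h3]; exact Nat.lt_succ_self _)
    refine hlt (lt_of_le_of_lt ?_ h3')
    push_cast
    push_cast at h1'
    gcongr

/-- The grid identity passes to the limit as the mesh tends to `0`, since the indicators are
eventually constant along almost every path. The factor on the right comes from the same limit with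
`a = 0`. -/
lemma IsPureBirthProcess.measure_inter_reachTime [IsFiniteMeasure P]
    (hX : IsPureBirthProcess P 1 rate X)
    {p : ℕ → ℕ → ℝ≥0 → ℝ} (hp : IsTransition P X p) {k : ℕ} {A : Set Ω}
    (hA : MeasurableSet[stoppedHistory P X k] A) (a : ℝ≥0) :
    P (A ∩ {ω | reachTime (fun t => X t ω) k + a < reachTime (fun t => X t ω) (k + 1)})
      = P (A ∩ {ω | reachTime (fun t => X t ω) k < reachTime (fun t => X t ω) (k + 1)})
        * ENNReal.ofReal (p (k + 1) (k + 1) a) := by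
  have lim : ∀ a : ℝ≥0, Tendsto (fun N : ℕ => P (A ∩ gridStay X k (1 / ((N : ℝ≥0) + 1)) a)) atTop
      (𝓝 (P (A ∩ {ω | reachTime (fun t => X t ω) k + a
        < reachTime (fun t => X t ω) (k + 1)}))) := by
    intro a
    refine tendsto_measure_of_ae_tendsto_indicator_of_isFiniteMeasure _ (hA.1.inter ?_)
      (fun N => hA.1.inter (hX.measurableSet_gridStay _ _ _)) ?_
    · exact measurableSet_lt ((measurable_reachTime_path hX.measurable k).add measurable_const)
        (measurable_reachTime_path hX.measurable (k + 1))
    · filter_upwards [hX.ae_isCountingPath] with ω hω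
      filter_upwards [hω.eventually_mem_gridStay_iff (k := k) (a := a)] with N hN
      simp only [Set.mem_inter_iff, hN, Set.mem_ofPred_eq]
  have h0 := lim 0
  simp only [ENNReal.coe_zero, add_zero] at h0
  refine tendsto_nhds_unique (lim a) ?_
  simp_rw [hX.measure_inter_gridStay hp hA _ a]
  exact ENNReal.Tendsto.mul_const h0 (Or.inr ENNReal.ofReal_ne_top)

end PureBirth

/-! ### Exponential sojourns and the absence of multiple jumps -/

/-- A multiplicative function on `[0, ∞)` with derivative `-r` at `0` is exponential. -/
lemma eq_exp_of_add_eq_mul {f : ℝ≥0 → ℝ} {r : ℝ} (hmul : ∀ a b, f (a + b) = f a * f b)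
    (hd : (fun h : ℝ≥0 => f h - (1 - r * h)) =o[𝓝[>] 0] fun h : ℝ≥0 => (h : ℝ)) (a : ℝ≥0) :
    f a = Real.exp (-(r * a)) := by
  have pos : ∀ a : ℝ≥0, 0 < a → f a = Real.exp (-(r * a)) := by
    intro a ha
    have hn : ∀ (n : ℕ) (b : ℝ≥0), f ((n + 1 : ℕ) * b) = f b ^ (n + 1) := by
      intro n b
      induction n with
      | zero => simp
      | succ n ih => rw [pow_succ, ← ih, ← hmul]; congr 1; push_cast; ring
    have hlim : Tendsto (fun n : ℕ => a / (n : ℝ≥0)) atTop (𝓝[>] 0) := by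
      refine tendsto_nhdsWithin_iff.2 ⟨?_, ?_⟩
      · have : Tendsto (fun n : ℕ => (a : ℝ) / n) atTop (𝓝 0) :=
          tendsto_const_nhds.div_atTop tendsto_natCast_atTop_atTop
        refine NNReal.tendsto_coe.1 ?_
        simpa using this
      · filter_upwards [eventually_gt_atTop 0] with n hn
        exact div_pos ha (by exact_mod_cast hn)
    have h1 := (hd.comp_tendsto hlim).tendsto_div_nhds_zero
    -- Combined with `f a = f (a / n) ^ n`, this gives the exponential as the limit of `(1 + x_n /
    -- n) ^ n` with `x_n → -(r * a)`.
    have h2 : Tendsto (fun n : ℕ => (n : ℝ) * (f (a / n) - 1)) atTop (𝓝 (-(r * a))) := by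
      have h3 := (h1.const_mul (a : ℝ)).add_const (-(r * a))
      simp only [mul_zero, zero_add] at h3
      refine h3.congr' ?_
      filter_upwards [eventually_gt_atTop 0] with n hn
      have hn' : (n : ℝ) ≠ 0 := by positivity
      have ha' : (a : ℝ) ≠ 0 := by exact_mod_cast ha.ne'
      simp only [Function.comp, NNReal.coe_div, NNReal.coe_natCast]
      field_simp
      ring
    have h4 := Real.tendsto_one_add_pow_exp_of_tendsto h2
    refine tendsto_nhds_unique (tendsto_const_nhds.congr' ?_) h4
    filter_upwards [eventually_gt_atTop 0] with n hn0
    obtain ⟨m, rfl⟩ := Nat.exists_eq_succ_of_ne_zero hn0.ne'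
    have := hn m (a / ((m + 1 : ℕ) : ℝ≥0))
    rw [mul_div_cancel₀ a (by positivity)] at this
    rw [this]
    simp
  rcases eq_or_ne a 0 with rfl | ha
  -- The derivative condition sees only positive times; the value at `0` comes from `f 1 = f 0 * f
  -- 1` with `f 1 > 0`.
  · have h := hmul 0 1
    rw [zero_add, pos 1 one_pos] at h
    have := Real.exp_pos (-(r * (1 : ℝ≥0)))
    simp only [NNReal.coe_zero, mul_zero, neg_zero, Real.exp_zero]
    nlinarith
  · exact pos a (pos_iff_ne_zero.2 ha)

section PureBirth

variable {Ω : Type*} [mΩ : MeasurableSpace Ω] {P : Measure Ω} {rate : ℕ → ℝ}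
  {X : ℝ≥0 → Ω → ℕ}

/-- Removing the two allowed transitions leaves the mass `P (X s = i) * (1 - p i i h - p i (i + 1)
h)`. The absolute value is there because `p i` is unconstrained by the Markov identity if the state
`i` has probability zero. -/
lemma IsTransition.measureReal_jump_le [IsProbabilityMeasure P] (hX : ∀ t, Measurable (X t))
    {p : ℕ → ℕ → ℝ≥0 → ℝ} (hp : IsTransition P X p) (s h : ℝ≥0) (i : ℕ) :
    P.real {ω | X s ω = i ∧ X (s + h) ω ≠ i ∧ X (s + h) ω ≠ i + 1}
      ≤ |1 - p i i h - p i (i + 1) h| := by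
  have hm := measurableSet_state hX
  have e1 := hp s h i i Set.univ MeasurableSet.univ
  have e2 := hp s h i (i + 1) Set.univ MeasurableSet.univ
  simp only [Set.univ_inter] at e1 e2
  have hu : {ω | X s ω = i} = {ω | X s ω = i ∧ X (s + h) ω ≠ i ∧ X (s + h) ω ≠ i + 1} ∪
      (({ω | X s ω = i} ∩ {ω | X (s + h) ω = i}) ∪
        ({ω | X s ω = i} ∩ {ω | X (s + h) ω = i + 1})) := by
    ext ω
    simp only [Set.mem_union, Set.mem_inter_iff, Set.mem_ofPred_eq]
    tauto
  have e3 := congrArg P.real hu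
  rw [measureReal_union _ (((hm _ _).inter (hm _ _)).union ((hm _ _).inter (hm _ _))),
    measureReal_union _ ((hm _ _).inter (hm _ _)), e1, e2] at e3
  · have h1 : P.real {ω | X s ω = i} ≤ 1 := measureReal_le_one
    have h0 : 0 ≤ P.real {ω | X s ω = i} := measureReal_nonneg
    calc _ = P.real {ω | X s ω = i} * (1 - p i i h - p i (i + 1) h) := by linarith
      _ ≤ P.real {ω | X s ω = i} * |1 - p i i h - p i (i + 1) h| := by
        gcongr; exact le_abs_self _
      _ ≤ _ := mul_le_of_le_one_left (abs_nonneg _) h1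
  · refine Set.disjoint_left.2 fun ω h1 h2 => ?_
    have h1 := h1.2; have h2 := h2.2
    simp only [Set.mem_ofPred_eq] at h1 h2
    omega
  · refine Set.disjoint_left.2 fun ω h1 h2 => ?_
    simp only [Set.mem_union, Set.mem_inter_iff, Set.mem_ofPred_eq] at h1 h2
    tauto

/-- If the levels `k` and `k + 1` are exceeded at the same time, the first grid point beyond `k` is
already beyond `k + 1`, so the preceding grid step jumps from a state at most `k` by at least two.
-/
lemma IsCountingPath.exists_grid_jump {f : ℝ≥0 → ℕ} (hf : IsCountingPath f) {k : ℕ} {T : ℝ≥0}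
    (hT : reachTime f (k + 1) ≤ T) (he : reachTime f (k + 1) ≤ reachTime f k) {N : ℕ}
    (hN : 0 < N) :
    ∃ m < N, ∃ i ∈ Finset.Icc 1 k, f (m * (T / N)) = i ∧ f (m * (T / N) + T / N) ≠ i ∧
      f (m * (T / N) + T / N) ≠ i + 1 := by
  have hend : k + 2 ≤ f (N * (T / N)) := by
    rw [mul_div_cancel₀ T (by positivity)]
    exact (hf.reachTime_le_iff (k + 1) T).1 hT
  have hex : ∃ m : ℕ, k + 1 ≤ f (m * (T / N)) := ⟨N, by omega⟩
  classical
  have h1 := Nat.find_spec hex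
  have h2 : k + 2 ≤ f (Nat.find hex * (T / N)) :=
    (hf.reachTime_le_iff (k + 1) _).1 (he.trans ((hf.reachTime_le_iff k _).2 h1))
  have h3 : Nat.find hex ≤ N := Nat.find_min' hex (by omega)
  have h4 : Nat.find hex ≠ 0 := by
    intro h0
    rw [h0] at h2
    simp only [Nat.cast_zero, zero_mul, hf.zero] at h2
    omega
  obtain ⟨m, hm⟩ := Nat.exists_eq_succ_of_ne_zero h4
  have h5 := Nat.find_min hex (m := m) (by omega)
  rw [hm] at h2
  have e : ((m.succ : ℕ) : ℝ≥0) * (T / N) = m * (T / N) + T / N := by push_cast; ring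
  rw [e] at h2
  have h6 : 1 ≤ f (m * (T / N)) := by
    rw [← hf.zero]; exact hf.mono zero_le
  refine ⟨m, by omega, f (m * (T / N)), Finset.mem_Icc.2 ⟨h6, by omega⟩, rfl, by omega, by omega⟩

/-- Union bound: up to time `T`, a double jump must show in one of `N` grid steps from one of `k`
states. Each such event has probability `o(T / N)`, because the two expansions add up to `1 + o(h)`;
the total is at most `ε * k * T` for every `ε > 0`. -/
lemma IsPureBirthProcess.ae_reachTime_lt_succ [IsProbabilityMeasure P]
    (hX : IsPureBirthProcess P 1 rate X) {p : ℕ → ℕ → ℝ≥0 → ℝ} (hp : IsTransition P X p)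
    (hp1 : ∀ k, 1 ≤ k →
      (fun h : ℝ≥0 => p k (k + 1) h - rate k * h) =o[𝓝[>] 0] fun h : ℝ≥0 => (h : ℝ))
    (hp2 : ∀ k, 1 ≤ k →
      (fun h : ℝ≥0 => p k k h - (1 - rate k * h)) =o[𝓝[>] 0] fun h : ℝ≥0 => (h : ℝ)) (k : ℕ) :
    ∀ᵐ ω ∂P, reachTime (fun t => X t ω) k ≠ ⊤ →
      reachTime (fun t => X t ω) k < reachTime (fun t => X t ω) (k + 1) := by
  have key : ∀ T : ℕ, ∀ᵐ ω ∂P, ¬ (reachTime (fun t => X t ω) (k + 1) ≤ ((T + 1 : ℕ) : ℝ≥0) ∧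
      reachTime (fun t => X t ω) (k + 1) ≤ reachTime (fun t => X t ω) k) := by
    intro T
    rw [ae_iff]
    simp only [not_not]
    set T' : ℝ≥0 := ((T + 1 : ℕ) : ℝ≥0) with hT'
    have hT0 : 0 < T' := by positivity
    have bound : ∀ ε : ℝ, 0 < ε → P {ω | reachTime (fun t => X t ω) (k + 1) ≤ T' ∧
        reachTime (fun t => X t ω) (k + 1) ≤ reachTime (fun t => X t ω) k}
          ≤ ENNReal.ofReal (ε * (k * T')) := by
      intro ε hε
      have hev : ∀ᶠ h : ℝ≥0 in 𝓝[>] 0, ∀ i ∈ Finset.Icc 1 k,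
          |1 - p i i h - p i (i + 1) h| ≤ ε * h := by
        refine (Filter.eventually_all_finset _).2 fun i hi => ?_
        have hi := (Finset.mem_Icc.1 hi).1
        have := ((hp1 i hi).add (hp2 i hi)).bound hε
        filter_upwards [this] with h hh
        rw [Real.norm_eq_abs, Real.norm_of_nonneg (NNReal.coe_nonneg h), ← abs_neg] at hh
        convert hh using 2
        ring
      have hlim : Tendsto (fun n : ℕ => T' / (n : ℝ≥0)) atTop (𝓝[>] 0) := by
        refine tendsto_nhdsWithin_iff.2 ⟨?_, ?_⟩
        · have : Tendsto (fun n : ℕ => (T' : ℝ) / n) atTop (𝓝 0) :=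
            tendsto_const_nhds.div_atTop tendsto_natCast_atTop_atTop
          refine NNReal.tendsto_coe.1 ?_
          simpa using this
        · filter_upwards [eventually_gt_atTop 0] with n hn
          exact div_pos hT0 (by exact_mod_cast hn)
      obtain ⟨N, hN, hN0⟩ := ((hlim.eventually hev).and (eventually_gt_atTop 0)).exists
      calc _ ≤ P (⋃ m ∈ Finset.range N, ⋃ i ∈ Finset.Icc 1 k,
            {ω | X (m * (T' / N)) ω = i ∧ X (m * (T' / N) + T' / N) ω ≠ i ∧
              X (m * (T' / N) + T' / N) ω ≠ i + 1}) := by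
            refine measure_mono_ae ?_
            filter_upwards [hX.ae_isCountingPath] with ω hω h
            obtain ⟨m, hm, i, hi, h'⟩ := hω.exists_grid_jump h.1 h.2 hN0
            exact Set.mem_biUnion (Finset.mem_coe.2 (Finset.mem_range.2 hm))
              (Set.mem_biUnion (Finset.mem_coe.2 hi) h')
        _ ≤ ∑ m ∈ Finset.range N, ∑ i ∈ Finset.Icc 1 k, ENNReal.ofReal (ε * (T' / N)) := by
            refine (measure_biUnion_finset_le _ _).trans (Finset.sum_le_sum fun m _ => ?_)
            refine (measure_biUnion_finset_le _ _).trans (Finset.sum_le_sum fun i hi => ?_)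
            rw [← ofReal_measureReal]
            refine ENNReal.ofReal_le_ofReal
              ((hp.measureReal_jump_le hX.measurable _ _ i).trans ?_)
            have := hN i hi
            push_cast at this
            exact this
        _ = ENNReal.ofReal (ε * (k * T')) := by
            have hN' : (N : ℝ) ≠ 0 := by positivity
            simp only [Finset.sum_const, Finset.card_range, Nat.card_Icc, add_tsub_cancel_right,
              nsmul_eq_mul]
            rw [← mul_assoc, ← ENNReal.ofReal_natCast, ← ENNReal.ofReal_natCast,
              ← ENNReal.ofReal_mul (by positivity), ← ENNReal.ofReal_mul (by positivity)]
            congr 1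
            field_simp
    have hlim : Tendsto (fun ε : ℝ => ENNReal.ofReal (ε * (k * T'))) (𝓝[>] 0) (𝓝 0) := by
      have : Tendsto (fun ε : ℝ => ε * (k * T')) (𝓝[>] 0) (𝓝 (0 * (k * T'))) :=
        (tendsto_id.mono_left nhdsWithin_le_nhds).mul_const _
      simpa using ENNReal.tendsto_ofReal this
    refine le_antisymm (ge_of_tendsto hlim ?_) zero_le
    filter_upwards [self_mem_nhdsWithin] with ε hε using bound ε hε
  filter_upwards [ae_all_iff.2 key] with ω h htop
  by_contra hlt
  push Not at hlt
  obtain ⟨T, hT⟩ := ENNReal.exists_nat_gt (ne_top_of_le_ne_top htop hlt)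
  refine h T ⟨hT.le.trans ?_, hlt⟩
  exact_mod_cast Nat.le_succ T

/-- The passage times are finite, and `X` stays in a state for an exponential time. -/
lemma IsPureBirthProcess.ae_reachTime_ne_top_and [IsProbabilityMeasure P]
    (hX : IsPureBirthProcess P 1 rate X) (hrate : ∀ k, 1 ≤ k → 0 < rate k)
    {p : ℕ → ℕ → ℝ≥0 → ℝ} (hp : IsTransition P X p)
    (hp1 : ∀ k, 1 ≤ k →
      (fun h : ℝ≥0 => p k (k + 1) h - rate k * h) =o[𝓝[>] 0] fun h : ℝ≥0 => (h : ℝ))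
    (hp2 : ∀ k, 1 ≤ k →
      (fun h : ℝ≥0 => p k k h - (1 - rate k * h)) =o[𝓝[>] 0] fun h : ℝ≥0 => (h : ℝ)) (k : ℕ) :
    (∀ᵐ ω ∂P, reachTime (fun t => X t ω) k ≠ ⊤) ∧
      ∀ a, p (k + 1) (k + 1) a = Real.exp (-(rate (k + 1) * a)) := by
  have hlt := hX.ae_reachTime_lt_succ hp hp1 hp2
  -- The two claims are interleaved: finiteness of the passage at `k` gives the exponential law in
  -- the state `k + 1`, which gives finiteness of the next passage.
  have main : ∀ k, (∀ᵐ ω ∂P, reachTime (fun t => X t ω) k ≠ ⊤) →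
      ∀ a, p (k + 1) (k + 1) a = Real.exp (-(rate (k + 1) * a)) := by
    intro k hk
    refine eq_exp_of_add_eq_mul (fun a b => ?_) (hp2 (k + 1) (by omega))
    -- The Markov identity determines `p (k + 1) (k + 1)` only if the state `k + 1` has positive
    -- probability at some time. Almost every path occupies it on a nondegenerate interval, which
    -- contains a point of the dense sequence.
    obtain ⟨s, hs⟩ : ∃ s, P.real {ω | X s ω = k + 1} ≠ 0 := by
      by_contra! hall
      have hall' : ∀ᵐ ω ∂P, ∀ n, X (TopologicalSpace.denseSeq ℝ≥0 n) ω ≠ k + 1 := by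
        refine ae_all_iff.2 fun n => ?_
        rw [ae_iff]
        simpa [measureReal_eq_zero_iff] using hall (TopologicalSpace.denseSeq ℝ≥0 n)
      have : ∀ᵐ ω ∂P, False := by
        filter_upwards [hall', hX.ae_isCountingPath, hk, hlt k] with ω h1 h2 h3 h4
        obtain ⟨x, hx1, hx2⟩ := ENNReal.lt_iff_exists_nnreal_btwn.1 (h4 h3)
        obtain ⟨y, hy1, hy2⟩ := ENNReal.lt_iff_exists_nnreal_btwn.1 hx2
        rw [ENNReal.coe_lt_coe] at hy1
        obtain ⟨_, ⟨h5, h6⟩, n, rfl⟩ :=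
          (TopologicalSpace.denseRange_denseSeq ℝ≥0).inter_open_nonempty _ isOpen_Ioo
            (Set.nonempty_Ioo.2 hy1)
        have h7 := (h2.reachTime_le_iff k _).1 (hx1.le.trans (ENNReal.coe_le_coe.2 h5.le))
        have h8 := (h2.lt_reachTime_iff (k + 1) _).1 ((ENNReal.coe_lt_coe.2 h6).trans hy2)
        exact h1 n (by omega)
      simp [ae_iff] at this
    have e1 := hp s a (k + 1) (k + 1) Set.univ MeasurableSet.univ
    have e2 := hp (s + a) b (k + 1) (k + 1) {ω | X s ω = k + 1}
      (measurable_pathHistory le_self_add (MeasurableSet.of_discrete (s := {k + 1})))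
    have e3 := hp s (a + b) (k + 1) (k + 1) Set.univ MeasurableSet.univ
    simp only [Set.univ_inter] at e1 e3
    rw [e1] at e2
    -- By monotonicity, a path in the state `k + 1` at both ends is there in between; this makes the
    -- diagonal transition probability multiplicative.
    have e4 : P.real ({ω | X s ω = k + 1} ∩ {ω | X (s + a) ω = k + 1} ∩
        {ω | X (s + a + b) ω = k + 1})
        = P.real ({ω | X s ω = k + 1} ∩ {ω | X (s + (a + b)) ω = k + 1}) := by
      refine measureReal_congr (eventuallyEq_set.2 ?_)
      filter_upwards [hX.ae_isCountingPath] with ω hω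
      simp only [Set.mem_inter_iff, Set.mem_ofPred_eq, ← add_assoc]
      have h1 : X s ω ≤ X (s + a) ω := hω.mono le_self_add
      have h2 : X (s + a) ω ≤ X (s + a + b) ω := hω.mono le_self_add
      constructor
      · rintro ⟨⟨h, -⟩, h'⟩; exact ⟨h, h'⟩
      · rintro ⟨h, h'⟩; exact ⟨⟨h, by omega⟩, h'⟩
    rw [e4, e3, mul_assoc] at e2
    exact mul_left_cancel₀ hs e2
  suffices h : ∀ᵐ ω ∂P, reachTime (fun t => X t ω) k ≠ ⊤ from ⟨h, main k h⟩
  induction k with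
  | zero =>
    filter_upwards [hX.ae_isCountingPath] with ω hω
    simp [hω.reachTime_zero]
  | succ k ih =>
    have hexp := main k ih
    rw [ae_iff]
    simp only [ne_eq, not_not]
    -- A sojourn that never ends outlasts every `a`.
    have bound : ∀ a : ℝ≥0, P {ω | reachTime (fun t => X t ω) (k + 1) = ⊤}
        ≤ ENNReal.ofReal (Real.exp (-(rate (k + 1) * a))) := by
      intro a
      have := hX.measure_inter_reachTime hp (k := k) (A := Set.univ) (@MeasurableSet.univ _
        (stoppedHistory P X k)) a
      simp only [Set.univ_inter] at this
      rw [← hexp a]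
      refine le_trans ?_ (mul_le_of_le_one_left zero_le prob_le_one |>.trans' this.le)
      refine measure_mono_ae ?_
      filter_upwards [ih] with ω h1 h2
      change _ + _ < _
      have h2 : reachTime (fun t => X t ω) (k + 1) = ⊤ := h2
      rw [h2]
      exact ENNReal.add_lt_top.2 ⟨lt_top_iff_ne_top.2 h1, ENNReal.coe_lt_top⟩
    have hlim : Tendsto (fun n : ℕ => ENNReal.ofReal (Real.exp (-(rate (k + 1) * (n : ℝ≥0)))))
        atTop (𝓝 0) := by
      have : Tendsto (fun n : ℕ => Real.exp (-(rate (k + 1) * n))) atTop (𝓝 0) :=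
        Real.tendsto_exp_neg_atTop_nhds_zero.comp
          (tendsto_natCast_atTop_atTop.const_mul_atTop (hrate _ (by omega)))
      simpa using ENNReal.tendsto_ofReal this
    exact le_antisymm (ge_of_tendsto' hlim fun n => bound n) zero_le

end PureBirth

/-! ### Law and independence of the holding times -/

lemma expMeasure_Ioi {r : ℝ} (hr : 0 < r) (a : ℝ) :
    expMeasure r (Set.Ioi a) = ENNReal.ofReal (Real.exp (-(r * max a 0))) := by
  have := isProbabilityMeasure_expMeasure hr
  rw [← Set.compl_Iic, prob_compl_eq_one_sub measurableSet_Iic, ← ofReal_cdf, cdf_expMeasure_eq hr,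
    ← ENNReal.ofReal_one, ← ENNReal.ofReal_sub _ ?_]
  · congr 1
    split_ifs with h
    · rw [max_eq_left h]; ring
    · rw [max_eq_right (not_le.1 h).le]; simp
  · split_ifs with h
    · have : Real.exp (-(r * a)) ≤ 1 := Real.exp_le_one_iff.2 (by nlinarith)
      linarith
    · exact le_rfl

lemma measure_ext_of_Ioi {μ ν : Measure ℝ} [IsFiniteMeasure μ] (h0 : μ Set.univ = ν Set.univ)
    (h : ∀ a, μ (Set.Ioi a) = ν (Set.Ioi a)) : μ = ν := by
  have : IsFiniteMeasure ν := ⟨by rw [← h0]; exact measure_lt_top _ _⟩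
  refine Measure.ext_of_Iic _ _ fun a => ?_
  rw [← Set.compl_Ioi, measure_compl measurableSet_Ioi (measure_ne_top _ _),
    measure_compl measurableSet_Ioi (measure_ne_top _ _), h0, h]

/-- The time that the path `f` spends between exceeding `k` and exceeding `k + 1`. -/
noncomputable def holdTime (f : ℝ≥0 → ℕ) (k : ℕ) : ℝ :=
  (reachTime f (k + 1)).toReal - (reachTime f k).toReal

lemma measurable_holdTime (k : ℕ) : Measurable fun f : ℝ≥0 → ℕ => holdTime f k :=
  (measurable_reachTime (k + 1)).ennreal_toReal.sub (measurable_reachTime k).ennreal_toReal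

section PureBirth

variable {Ω : Type*} [mΩ : MeasurableSpace Ω] {P : Measure Ω} {rate : ℕ → ℝ}
  {X : ℝ≥0 → Ω → ℕ}

lemma IsPureBirthProcess.measurable_holdTime_stoppedHistory
    (hX : IsPureBirthProcess P 1 rate X) {i k : ℕ} (hik : i < k) :
    Measurable[stoppedHistory P X k] fun ω => holdTime (fun t => X t ω) i := by
  refine @Measurable.sub _ _ _ _ (stoppedHistory P X k) _ _ _ ?_ ?_
  · exact @Measurable.ennreal_toReal _ (stoppedHistory P X k) _
      (hX.measurable_reachTime_stoppedHistory hik)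
  · exact @Measurable.ennreal_toReal _ (stoppedHistory P X k) _
      (hX.measurable_reachTime_stoppedHistory hik.le)

/-- The passage times of almost every path are finite and strictly increasing. -/
lemma IsPureBirthProcess.ae_reachTime [IsProbabilityMeasure P]
    (hX : IsPureBirthProcess P 1 rate X) (hrate : ∀ k, 1 ≤ k → 0 < rate k) :
    ∀ᵐ ω ∂P, ∀ k, reachTime (fun t => X t ω) k ≠ ⊤ ∧
      reachTime (fun t => X t ω) k < reachTime (fun t => X t ω) (k + 1) := by
  obtain ⟨p, hp, hp1, hp2⟩ := hX.markov
  refine ae_all_iff.2 fun k => ?_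
  filter_upwards [(hX.ae_reachTime_ne_top_and hrate hp hp1 hp2 k).1,
    hX.ae_reachTime_lt_succ hp hp1 hp2 k] with ω h1 h2
  exact ⟨h1, h2 h1⟩

/-- The holding time is independent of the events in the stopped history. The strong Markov identity
gives its survival function under `P` restricted to `A`, and survival functions determine finite
measures. -/
lemma IsPureBirthProcess.measure_inter_holdTime [IsProbabilityMeasure P]
    (hX : IsPureBirthProcess P 1 rate X) (hrate : ∀ k, 1 ≤ k → 0 < rate k) {k : ℕ} {A : Set Ω}
    (hA : MeasurableSet[stoppedHistory P X k] A) {B : Set ℝ} (hB : MeasurableSet B) :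
    P (A ∩ {ω | holdTime (fun t => X t ω) k ∈ B}) = P A * expMeasure (rate (k + 1)) B := by
  have hr := hrate (k + 1) (by omega)
  have := isProbabilityMeasure_expMeasure hr
  have hm : Measurable fun ω => holdTime (fun t => X t ω) k :=
    (measurable_holdTime k).comp (measurable_pi_iff.2 hX.measurable)
  have hA' : MeasurableSet A := stoppedHistory_le k _ hA
  have hfin := hX.ae_reachTime hrate
  have key : (P.restrict A).map (fun ω => holdTime (fun t => X t ω) k)
      = P A • expMeasure (rate (k + 1)) := by
    have surv : ∀ a : ℝ≥0, P (A ∩ {ω | (a : ℝ) < holdTime (fun t => X t ω) k})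
        = P A * ENNReal.ofReal (Real.exp (-(rate (k + 1) * a))) := by
      intro a
      obtain ⟨p, hp, hp1, hp2⟩ := hX.markov
      have h1 := hX.measure_inter_reachTime hp hA a
      rw [(hX.ae_reachTime_ne_top_and hrate hp hp1 hp2 k).2 a] at h1
      -- Passage times increase strictly almost surely, so the extra event in the strong Markov
      -- identity can be dropped.
      have e : (A ∩ {ω | reachTime (fun t => X t ω) k
          < reachTime (fun t => X t ω) (k + 1)} : Set Ω) =ᵐ[P] (A : Set Ω) := by
        refine eventuallyEq_set.2 ?_
        filter_upwards [hfin] with ω hω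
        exact ⟨fun h => h.1, fun h => ⟨h, (hω k).2⟩⟩
      have e' : (A ∩ {ω | (a : ℝ) < holdTime (fun t => X t ω) k} : Set Ω) =ᵐ[P]
          (A ∩ {ω | reachTime (fun t => X t ω) k + a
            < reachTime (fun t => X t ω) (k + 1)} : Set Ω) := by
        refine eventuallyEq_set.2 ?_
        filter_upwards [hfin] with ω hω
        refine and_congr_right fun _ => ?_
        change (a : ℝ) < holdTime (fun t => X t ω) k ↔
          reachTime (fun t => X t ω) k + a < reachTime (fun t => X t ω) (k + 1)
        have h2 := (hω k).1
        have h3 := (hω (k + 1)).1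
        rw [← ENNReal.toReal_lt_toReal (ENNReal.add_ne_top.2 ⟨h2, ENNReal.coe_ne_top⟩) h3,
          ENNReal.toReal_add h2 ENNReal.coe_ne_top, holdTime, lt_sub_iff_add_lt']
        rfl
      rw [measure_congr e', h1, measure_congr e]
    refine measure_ext_of_Ioi ?_ fun a => ?_
    · rw [Measure.map_apply hm .univ]; simp
    · rw [Measure.map_apply hm measurableSet_Ioi, Measure.restrict_apply (hm measurableSet_Ioi),
        Set.inter_comm, Measure.smul_apply, expMeasure_Ioi hr, smul_eq_mul]
      rcases le_or_gt 0 a with ha | ha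
      · rw [max_eq_left ha]
        exact surv ⟨a, ha⟩
      · rw [max_eq_right ha.le, mul_zero, neg_zero, Real.exp_zero, ENNReal.ofReal_one, mul_one]
        refine measure_congr (eventuallyEq_set.2 ?_)
        filter_upwards [hfin] with ω hω
        refine ⟨fun h => h.1, fun h => ⟨h, ha.trans ?_⟩⟩
        exact sub_pos.2 ((ENNReal.toReal_lt_toReal (hω k).1 (hω (k + 1)).1).2 (hω k).2)
  have := congrArg (fun μ => μ B) key
  simp only [Measure.map_apply hm hB, Measure.restrict_apply (hm hB), Measure.smul_apply,
    smul_eq_mul] at this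
  rw [← this, Set.inter_comm]
  rfl

lemma IsPureBirthProcess.map_holdTime [IsProbabilityMeasure P]
    (hX : IsPureBirthProcess P 1 rate X) (hrate : ∀ k, 1 ≤ k → 0 < rate k) (k : ℕ) :
    P.map (fun ω => holdTime (fun t => X t ω) k) = expMeasure (rate (k + 1)) := by
  have hm : Measurable fun ω => holdTime (fun t => X t ω) k :=
    (measurable_holdTime k).comp (measurable_pi_iff.2 hX.measurable)
  ext B hB
  have := hX.measure_inter_holdTime hrate (k := k) (A := Set.univ)
    (@MeasurableSet.univ _ (stoppedHistory P X k)) hB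
  rw [Measure.map_apply hm hB]
  rw [Set.univ_inter, measure_univ, one_mul] at this
  exact this

/-- The holding times of a pure birth process are independent. -/
lemma IsPureBirthProcess.iIndepFun_holdTime [IsProbabilityMeasure P]
    (hX : IsPureBirthProcess P 1 rate X) (hrate : ∀ k, 1 ≤ k → 0 < rate k) :
    iIndepFun (fun (k : ℕ) ω => holdTime (fun t => X t ω) k) P := by
  have hm : ∀ k, Measurable fun ω => holdTime (fun t => X t ω) k := fun k =>
    (measurable_holdTime k).comp (measurable_pi_iff.2 hX.measurable)
  have range : ∀ (n : ℕ) (B : ℕ → Set ℝ), (∀ i, MeasurableSet (B i)) →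
      P (⋂ i ∈ Finset.range n, (fun ω => holdTime (fun t => X t ω) i) ⁻¹' B i)
        = ∏ i ∈ Finset.range n, P ((fun ω => holdTime (fun t => X t ω) i) ⁻¹' B i) := by
    intro n B hB
    induction n with
    | zero => simp
    | succ n ih =>
      have hA : MeasurableSet[stoppedHistory P X n]
          (⋂ i ∈ Finset.range n, (fun ω => holdTime (fun t => X t ω) i) ⁻¹' B i) :=
        @Finset.measurableSet_biInter _ _ (stoppedHistory P X n) _ _ fun i hi =>
          hX.measurable_holdTime_stoppedHistory (Finset.mem_range.1 hi) (hB i)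
      have h1 := hX.measure_inter_holdTime hrate hA (hB n)
      rw [Finset.prod_range_succ, ← ih, ← Measure.map_apply (hm n) (hB n), hX.map_holdTime hrate,
        ← h1, Finset.range_add_one, Finset.set_biInter_insert, Set.inter_comm]
      rfl
  rw [iIndepFun_iff_measure_inter_preimage_eq_mul]
  intro S B hB
  classical
  obtain ⟨n, hn⟩ : ∃ n, S ⊆ Finset.range n := S.exists_nat_subset_range
  -- Indices below `n` outside `S` receive the whole line, which contributes a factor `1`.
  have h := range n (fun i => if i ∈ S then B i else Set.univ) (fun i => by
    split_ifs with hi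
    · exact hB i hi
    · exact .univ)
  rw [← Finset.prod_subset hn (f := fun i => P ((fun ω => holdTime (fun t => X t ω) i) ⁻¹'
    (if i ∈ S then B i else Set.univ))) (fun i _ hi => by simp [hi])] at h
  convert h using 2
  · ext ω
    simp only [Set.mem_iInter, Set.mem_preimage]
    constructor
    · intro h i _
      split_ifs with hi
      · exact h i hi
      · trivial
    · intro h i hi
      simpa [hi] using h i (hn hi)
  · rename_i i hi
    simp [hi]

end PureBirth

/-! ### Competing exponential clocks -/

/-- Memorylessness of the exponential distribution. -/
lemma expMeasure_shift {r : ℝ} (hr : 0 < r) {t : ℝ} (ht : 0 ≤ t) {B : Set ℝ}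
    (hB : MeasurableSet B) :
    expMeasure r {y | t < y ∧ y - t ∈ B}
      = ENNReal.ofReal (Real.exp (-(r * t))) * expMeasure r B := by
  have := isProbabilityMeasure_expMeasure hr
  have hm : Measurable fun y : ℝ => y - t := measurable_id.sub_const t
  have key : ((expMeasure r).restrict (Set.Ioi t)).map (fun y => y - t)
      = ENNReal.ofReal (Real.exp (-(r * t))) • expMeasure r := by
    refine measure_ext_of_Ioi ?_ fun a => ?_
    · rw [Measure.map_apply hm .univ, Set.preimage_univ, Measure.restrict_apply_univ,
        expMeasure_Ioi hr, max_eq_left ht]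
      simp
    · rw [Measure.map_apply hm measurableSet_Ioi, Measure.restrict_apply (hm measurableSet_Ioi),
        Measure.smul_apply, smul_eq_mul, expMeasure_Ioi hr,
        ← ENNReal.ofReal_mul (Real.exp_pos _).le, ← Real.exp_add]
      have : (fun y => y - t) ⁻¹' Set.Ioi a ∩ Set.Ioi t = Set.Ioi (max a 0 + t) := by
        ext y
        simp only [Set.mem_inter_iff, Set.mem_preimage, Set.mem_Ioi, ← lt_sub_iff_add_lt,
          max_lt_iff, sub_pos]
      rw [this, expMeasure_Ioi hr, max_eq_left (by positivity)]
      congr 2; ring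
  have h := congrArg (fun μ => μ B) key
  simp only [Measure.map_apply hm hB, Measure.restrict_apply (hm hB), Measure.smul_apply,
    smul_eq_mul] at h
  rw [← h, Set.inter_comm]
  rfl

lemma lintegral_exp_expMeasure {r R : ℝ} (hr : 0 < r) (hR : 0 ≤ R) :
    ∫⁻ t, ENNReal.ofReal (Real.exp (-(R * t))) ∂(expMeasure r) = ENNReal.ofReal (r / (r + R)) := by
  have hm : Measurable fun t : ℝ => ENNReal.ofReal (Real.exp (-(R * t))) := by fun_prop
  have hd : expMeasure r
      = volume.withDensity fun t => ENNReal.ofReal (exponentialPDFReal r t) := rfl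
  rw [hd, lintegral_withDensity_eq_lintegral_mul _
    (measurable_exponentialPDFReal r).ennreal_ofReal hm]
  calc _ = ∫⁻ t, ENNReal.ofReal (r / (r + R)) * exponentialPDF (r + R) t := by
        refine lintegral_congr fun t => ?_
        simp only [Pi.mul_apply]
        rw [← exponentialPDF, exponentialPDF_eq, exponentialPDF_eq]
        split_ifs with h
        · rw [← ENNReal.ofReal_mul (by positivity), ← ENNReal.ofReal_mul (by positivity)]
          congr 1
          have : -((r + R) * t) = -(r * t) + -(R * t) := by ring
          rw [this, Real.exp_add]
          field_simp
        · simp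
    _ = _ := by
        rw [lintegral_const_mul' _ _ ENNReal.ofReal_ne_top,
          lintegral_exponentialPDF_eq_one (by positivity), mul_one]

section Race

variable {Ω ι : Type*} [MeasurableSpace Ω] {Q : Measure Ω} {U : Set ι} {r : ι → ℝ}
  {Z : ι → Ω → ℝ}

/-- The random variables `Z i`, `i ∈ U`, are independent and exponential with rates `r i`. -/
def IndepExp (Q : Measure Ω) (U : Set ι) (r : ι → ℝ) (Z : ι → Ω → ℝ) : Prop :=
  ∀ S : Finset ι, ↑S ⊆ U → ∀ B : ι → Set ℝ, (∀ i, MeasurableSet (B i)) →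
    Q (⋂ i ∈ S, Z i ⁻¹' B i) = ∏ i ∈ S, expMeasure (r i) (B i)

/-- The product formula on rectangles identifies the joint law. The clock `i` is split off so that
the race can be computed by Fubini, at a fixed ringing time of `i`. -/
lemma IndepExp.map_prod_eq [IsProbabilityMeasure Q] (h : IndepExp Q U r Z)
    (hZ : ∀ i, Measurable (Z i)) (hr : ∀ i ∈ U, 0 < r i) {i : ι} (hi : i ∈ U) {S : Finset ι}
    (hS : ↑S ⊆ U) (hiS : i ∉ S) :
    Q.map (fun ω => (Z i ω, fun j : S => Z j ω))
      = (expMeasure (r i)).prod (Measure.pi fun j : S => expMeasure (r j)) := by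
  classical
  have hp : ∀ j : S, IsProbabilityMeasure (expMeasure (r j)) := fun j =>
    isProbabilityMeasure_expMeasure (hr j (hS j.2))
  have hp' := isProbabilityMeasure_expMeasure (hr i hi)
  have hm : Measurable fun ω => (Z i ω, fun j : S => Z j ω) :=
    (hZ i).prodMk (measurable_pi_iff.2 fun j => hZ j)
  symm
  refine Measure.prod_eq_generateFrom (C := {s | MeasurableSet s})
    (D := Set.pi Set.univ '' Set.pi Set.univ fun _ : S => {s : Set ℝ | MeasurableSet s})
    MeasurableSpace.generateFrom_measurableSet generateFrom_pi
    MeasurableSpace.isPiSystem_measurableSet isPiSystem_pi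
    ⟨fun _ => Set.univ, fun _ => by simp, fun _ => measure_lt_top _ _,
      Set.iUnion_const _⟩
    ⟨fun _ => Set.univ, fun _ => ⟨fun _ => Set.univ, fun _ _ => by simp,
      Set.pi_univ _⟩, fun _ => measure_lt_top _ _, Set.iUnion_const _⟩ ?_
  rintro s hs _ ⟨t, ht, rfl⟩
  have ht : ∀ j, MeasurableSet (t j) := fun j => ht j trivial
  have hs : MeasurableSet s := hs
  rw [Measure.map_apply hm (hs.prod (MeasurableSet.univ_pi ht)), Measure.pi_pi]
  have h1 := h (insert i S) (by
      intro j hj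
      rcases Finset.mem_insert.1 (Finset.mem_coe.1 hj) with rfl | hj
      · exact hi
      · exact hS hj)
    (fun j => if hj : j ∈ S then t ⟨j, hj⟩ else s) (fun j => by
      split_ifs with hj
      · exact ht _
      · exact hs)
  rw [Finset.prod_insert hiS, dif_neg hiS, ← Finset.prod_attach] at h1
  simp only [Finset.coe_mem, dif_pos] at h1
  rw [Finset.univ_eq_attach, ← h1]
  congr 1
  ext ω
  simp only [Set.mem_preimage, Set.mem_prod, Set.mem_univ_pi, Subtype.forall, Set.mem_iInter,
    Finset.mem_insert, forall_eq_or_imp, dif_neg hiS]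
  refine and_congr_right fun _ => forall₂_congr fun j hj => ?_
  rw [dif_pos hj]

/-- The event that the clock `i` rings strictly before the other clocks in `A`. -/
def ringsFirst (Z : ι → Ω → ℝ) (A : Finset ι) (i : ι) : Set Ω :=
  {ω | ∀ j ∈ A, j ≠ i → Z i ω < Z j ω}

lemma measurableSet_ringsFirst (hZ : ∀ i, Measurable (Z i)) (A : Finset ι) (i : ι) :
    MeasurableSet (ringsFirst Z A i) := by
  have : ringsFirst Z A i = ⋂ j ∈ A, {ω | j ≠ i → Z i ω < Z j ω} := by
    ext ω; simp [ringsFirst]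
  rw [this]
  refine A.measurableSet_biInter fun j _ => ?_
  by_cases hj : j = i
  · simp [hj]
  · simpa [hj] using measurableSet_lt (hZ i) (hZ j)

open Classical in
/-- The clocks after the clock `i` has rung: the clocks in `A` have been running. -/
noncomputable def clockAfter (Z : ι → Ω → ℝ) (A : Finset ι) (i j : ι) (ω : Ω) : ℝ :=
  if j ∈ A then Z j ω - Z i ω else Z j ω

/-- Fix the ringing time `t` of the clock `i`. Each other clock `j ∈ A` survives `t` with
probability `exp (-(r j * t))`, and its residual then has its original law. With `R` the total rate
of these competitors, integrating `exp (-(R * t))` against the law of the clock `i` gives `r i / (r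
i + R)`. The inclusion `A.erase i ⊆ S` makes the event depend on the clocks `i` and `S` alone. -/
lemma IndepExp.measure_ringsFirst_inter_aux [DecidableEq ι] [IsProbabilityMeasure Q]
    (h : IndepExp Q U r Z)
    (hZ : ∀ i, Measurable (Z i)) (hr : ∀ i ∈ U, 0 < r i) {A : Finset ι} (hA : ↑A ⊆ U) {i : ι}
    (hi : i ∈ A) {S : Finset ι} (hS : ↑S ⊆ U) (hiS : i ∉ S) (hAS : A.erase i ⊆ S)
    {B : ι → Set ℝ} (hB : ∀ i, MeasurableSet (B i)) :
    Q (ringsFirst Z A i ∩ ⋂ j ∈ S, clockAfter Z A i j ⁻¹' B j)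
      = ENNReal.ofReal (r i / ∑ j ∈ A, r j) * ∏ j ∈ S, expMeasure (r j) (B j) := by
  have hp : ∀ j : S, IsProbabilityMeasure (expMeasure (r j)) := fun j =>
    isProbabilityMeasure_expMeasure (hr j (hS j.2))
  have hri := hr i (hA hi)
  have hp' := isProbabilityMeasure_expMeasure hri
  have hm : Measurable fun ω => (Z i ω, fun j : S => Z j ω) :=
    (hZ i).prodMk (measurable_pi_iff.2 fun j => hZ j)
  let C : ℝ → S → Set ℝ := fun t j => if (j : ι) ∈ A then {y | t < y ∧ y - t ∈ B j} else B j
  let T : Set (ℝ × (S → ℝ)) := {q | ∀ j, q.2 j ∈ C q.1 j}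
  have hT : MeasurableSet T := by
    have : T = ⋂ j, {q | q.2 j ∈ C q.1 j} := by ext q; simp [T]
    rw [this]
    refine MeasurableSet.iInter fun j => ?_
    have h2 : Measurable fun q : ℝ × (S → ℝ) => q.2 j :=
      (measurable_pi_apply j).comp measurable_snd
    by_cases hj : (j : ι) ∈ A
    · simp only [C, if_pos hj, Set.mem_ofPred_eq]
      exact (measurableSet_lt measurable_fst h2).inter ((h2.sub measurable_fst) (hB j))
    · simp only [C, if_neg hj]
      exact h2 (hB j)
  have e : ringsFirst Z A i ∩ ⋂ j ∈ S, clockAfter Z A i j ⁻¹' B j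
      = (fun ω => (Z i ω, fun j : S => Z j ω)) ⁻¹' T := by
    ext ω
    simp only [Set.mem_inter_iff, Set.mem_iInter, Set.mem_preimage, ringsFirst, Set.mem_ofPred_eq,
      clockAfter, T, C, Subtype.forall]
    constructor
    · rintro ⟨h1, h2⟩ j hj
      have h3 := h2 j hj
      by_cases hjA : j ∈ A
      · rw [if_pos hjA] at h3 ⊢
        exact ⟨h1 j hjA (fun h => hiS (h ▸ hj)), h3⟩
      · rwa [if_neg hjA] at h3 ⊢
    · intro h1
      refine ⟨fun j hjA hji => ?_, fun j hj => ?_⟩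
      · have := h1 j (hAS (Finset.mem_erase.2 ⟨hji, hjA⟩))
        rw [if_pos hjA] at this
        exact this.1
      · have := h1 j hj
        by_cases hjA : j ∈ A
        · rw [if_pos hjA] at this ⊢
          exact this.2
        · rwa [if_neg hjA] at this ⊢
  have hR : ∑ j ∈ A, r j = r i + ∑ j ∈ A.erase i, r j := (Finset.add_sum_erase A r hi).symm
  have hR0 : 0 ≤ ∑ j ∈ A.erase i, r j :=
    Finset.sum_nonneg fun j hj => (hr j (hA (Finset.mem_of_mem_erase hj))).le
  rw [e, ← Measure.map_apply hm hT, h.map_prod_eq hZ hr (hA hi) hS hiS, Measure.prod_apply hT, hR,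
    ← lintegral_exp_expMeasure hri hR0, ← lintegral_mul_const _ (by fun_prop)]
  -- Memorylessness is available only for shifts by a nonnegative time.
  have hpos : ∀ᵐ t ∂(expMeasure (r i)), 0 ≤ t := by
    rw [ae_iff]
    have h0 : expMeasure (r i) (Set.Ioi 0) = 1 := by rw [expMeasure_Ioi hri]; simp
    have h1 := (prob_compl_eq_zero_iff (μ := expMeasure (r i)) measurableSet_Ioi).2 h0
    exact measure_mono_null (fun t ht => by simpa using (not_le.1 ht).le) h1
  refine lintegral_congr_ae ?_
  filter_upwards [hpos] with t ht
  have e1 : Prod.mk t ⁻¹' T = Set.univ.pi (C t) := by ext y; simp [T]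
  rw [e1, Measure.pi_pi]
  have e2 : ∀ j : S, expMeasure (r j) (C t j)
      = (if (j : ι) ∈ A then ENNReal.ofReal (Real.exp (-(r j * t))) else 1)
        * expMeasure (r j) (B j) := by
    intro j
    by_cases hj : (j : ι) ∈ A
    · simp only [C, if_pos hj]
      exact expMeasure_shift (hr j (hS j.2)) ht (hB j)
    · simp only [C, if_neg hj, one_mul]
  simp_rw [e2]
  rw [Finset.univ_eq_attach, Finset.prod_attach S (fun j =>
    (if j ∈ A then ENNReal.ofReal (Real.exp (-(r j * t))) else 1) * expMeasure (r j) (B j)),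
    Finset.prod_mul_distrib]
  congr 1
  rw [← Finset.prod_subset hAS, Finset.sum_mul, ← Finset.sum_neg_distrib, Real.exp_sum,
    ENNReal.ofReal_prod_of_nonneg (fun _ _ => (Real.exp_pos _).le)]
  · exact Finset.prod_congr rfl fun j hj => by rw [if_pos (Finset.mem_of_mem_erase hj)]
  · intro j hj hj'
    rw [if_neg]
    exact fun hjA => hj' (Finset.mem_erase.2 ⟨fun h => hiS (h ▸ hj), hjA⟩)

/-- The competitors missing from `S` are added with the trivial constraint `Set.univ`. -/
lemma IndepExp.measure_ringsFirst_inter [IsProbabilityMeasure Q] (h : IndepExp Q U r Z)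
    (hZ : ∀ i, Measurable (Z i)) (hr : ∀ i ∈ U, 0 < r i) {A : Finset ι} (hA : ↑A ⊆ U) {i : ι}
    (hi : i ∈ A) {S : Finset ι} (hS : ↑S ⊆ U \ {i})
    {B : ι → Set ℝ} (hB : ∀ i, MeasurableSet (B i)) :
    Q (ringsFirst Z A i ∩ ⋂ j ∈ S, clockAfter Z A i j ⁻¹' B j)
      = ENNReal.ofReal (r i / ∑ j ∈ A, r j) * ∏ j ∈ S, expMeasure (r j) (B j) := by
  classical
  have hiS : i ∉ S := fun hi' => (hS hi').2 rfl
  have h1 := h.measure_ringsFirst_inter_aux hZ hr hA hi (S := S ∪ A.erase i)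
    (fun j hj => by
      rcases Finset.mem_union.1 (Finset.mem_coe.1 hj) with hj | hj
      · exact (hS hj).1
      · exact hA (Finset.mem_of_mem_erase hj))
    (by simp [hiS]) Finset.subset_union_right
    (B := fun j => if j ∈ S then B j else Set.univ)
    (fun j => by split_ifs; exacts [hB j, .univ])
  rw [← Finset.prod_subset (Finset.subset_union_left (s₁ := S) (s₂ := A.erase i))] at h1
  · convert h1 using 2
    · congr 1
      ext ω
      simp only [Set.mem_iInter, Set.mem_preimage]
      constructor
      · intro h2 j _
        split_ifs with hj
        · exact h2 j hj
        · trivial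
      · intro h2 j hj
        simpa [hj] using h2 j (Finset.mem_union_left _ hj)
    · exact Finset.prod_congr rfl fun j hj => by rw [if_pos hj]
  · intro j hj hj'
    have hjA : j ∈ A := by
      rcases Finset.mem_union.1 hj with hj | hj
      · exact absurd hj hj'
      · exact Finset.mem_of_mem_erase hj
    have := isProbabilityMeasure_expMeasure (hr j (hA hjA))
    rw [if_neg hj', measure_univ]

/-- Which of finitely many independent exponential clocks rings first. -/
lemma IndepExp.measure_ringsFirst [IsProbabilityMeasure Q] (h : IndepExp Q U r Z)
    (hZ : ∀ i, Measurable (Z i)) (hr : ∀ i ∈ U, 0 < r i) {A : Finset ι} (hA : ↑A ⊆ U) {i : ι}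
    (hi : i ∈ A) : Q (ringsFirst Z A i) = ENNReal.ofReal (r i / ∑ j ∈ A, r j) := by
  simpa using h.measure_ringsFirst_inter hZ hr hA hi (S := ∅) (by simp) (B := fun _ => Set.univ)
    (fun _ => .univ)

/-- Given which clock rings first, the residual clocks are again independent and exponential. -/
lemma IndepExp.cond_ringsFirst [IsProbabilityMeasure Q] (h : IndepExp Q U r Z)
    (hZ : ∀ i, Measurable (Z i)) (hr : ∀ i ∈ U, 0 < r i) {A : Finset ι} (hA : ↑A ⊆ U) {i : ι}
    (hi : i ∈ A) : IndepExp (Q[|ringsFirst Z A i]) (U \ {i}) r (clockAfter Z A i) := by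
  intro S hS B hB
  rw [cond_apply (measurableSet_ringsFirst hZ A i), h.measure_ringsFirst_inter hZ hr hA hi hS hB,
    h.measure_ringsFirst hZ hr hA hi, ← mul_assoc, ENNReal.inv_mul_cancel, one_mul]
  · have h0 : 0 < ∑ j ∈ A, r j := Finset.sum_pos (fun j hj => hr j (hA hj)) ⟨i, hi⟩
    exact (ENNReal.ofReal_pos.2 (div_pos (hr i (hA hi)) h0)).ne'
  · exact ENNReal.ofReal_ne_top

end Race

/-! ### The order of births -/

/-- The individual at whose birth the clock of the birth of `y` starts: the next older sibling, or
the parent if there is none. -/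
def prevBirth : List ℕ → List ℕ
  | [] => []
  | 0 :: x => x
  | (j + 1) :: x => j :: x

lemma prevBirth_induction {p : List ℕ → Prop} (nil : p [])
    (step : ∀ y, y ≠ [] → p (prevBirth y) → p y) (y : List ℕ) : p y := by
  induction y with
  | nil => exact nil
  | cons j x ih =>
    induction j with
    | zero => exact step _ (by simp) ih
    | succ j ihj => exact step _ (by simp) ihj

/-- The birth times, when `e y` is the time between the births of `prevBirth y` and `y`. -/
def bornAt (e : List ℕ → ℝ) : List ℕ → ℝ
  | [] => 0
  | j :: x => bornAt e x + ∑ i ∈ Finset.range (j + 1), e (i :: x)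

lemma bornAt_eq (e : List ℕ → ℝ) {y : List ℕ} (hy : y ≠ []) :
    bornAt e y = bornAt e (prevBirth y) + e y := by
  match y, hy with
  | 0 :: x, _ => simp [bornAt, prevBirth]
  | (j + 1) :: x, _ => rw [prevBirth, bornAt, bornAt, Finset.sum_range_succ _ (j + 1), add_assoc]

lemma measurable_bornAt {Ω : Type*} [MeasurableSpace Ω] {E : List ℕ → Ω → ℝ}
    (hE : ∀ y, Measurable (E y)) (y : List ℕ) : Measurable fun ω => bornAt (E · ω) y := by
  induction y with
  | nil => exact measurable_const
  | cons j x ih => exact ih.add (Finset.measurable_sum _ fun i _ => hE _)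

/-- The number of children of `x` in `F`. -/
def childCount (F : Finset (List ℕ)) (x : List ℕ) : ℕ :=
  (F.filter fun y => y ≠ [] ∧ y.tail = x).card

/-- `F` contains the root, and is closed under `prevBirth`. -/
structure Explored (F : Finset (List ℕ)) : Prop where
  nil_mem : [] ∈ F
  prevBirth_mem : ∀ y ∈ F, prevBirth y ∈ F

/-- The individuals that may be born next. -/
def frontier (F : Finset (List ℕ)) : Finset (List ℕ) :=
  F.image fun x => childCount F x :: x

namespace Explored

variable {F : Finset (List ℕ)} (hF : Explored F)
include hF

lemma parent_mem {j : ℕ} {x : List ℕ} (h : j :: x ∈ F) : x ∈ F := by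
  induction j with
  | zero => exact hF.prevBirth_mem _ h
  | succ j ih => exact ih (hF.prevBirth_mem _ h)

/-- Closure under `prevBirth` means that the children of `x` in `F` form an initial segment of the
siblings. By finiteness there is a least missing index, and it is the number of children. -/
lemma cons_mem_iff (j : ℕ) (x : List ℕ) : j :: x ∈ F ↔ j < childCount F x := by
  have hex : ∃ n, n :: x ∉ F := by
    obtain ⟨n, hn⟩ := Infinite.exists_notMem_finset
      (F.preimage (fun n : ℕ => n :: x) fun a _ b _ h => (List.cons.inj h).1)
    exact ⟨n, fun h => hn (Finset.mem_preimage.2 h)⟩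
  have hiff : ∀ i, i :: x ∈ F ↔ i < Nat.find hex := by
    intro i
    refine ⟨fun h => ?_, fun h => not_not.1 (Nat.find_min hex h)⟩
    by_contra hle
    have down : ∀ m i, (i + m) :: x ∈ F → i :: x ∈ F := by
      intro m
      induction m with
      | zero => exact fun i h => h
      | succ m ih => exact fun i h => ih i (hF.prevBirth_mem _ h)
    refine Nat.find_spec hex (down (i - Nat.find hex) _ ?_)
    rwa [Nat.add_sub_cancel' (not_lt.1 hle)]
  rw [hiff]
  suffices h : childCount F x = Nat.find hex by rw [h]
  have : (F.filter fun y => y ≠ [] ∧ y.tail = x)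
      = (Finset.range (Nat.find hex)).image fun i => i :: x := by
    ext y
    simp only [Finset.mem_filter, Finset.mem_image, Finset.mem_range, ← hiff]
    constructor
    · rintro ⟨h1, h2, h3⟩
      match y, h2 with
      | i :: x', _ =>
        rw [List.tail_cons] at h3
        subst h3
        exact ⟨i, h1, rfl⟩
    · rintro ⟨i, hi, rfl⟩
      exact ⟨hi, by simp, rfl⟩
  rw [childCount, this, Finset.card_image_of_injective _ fun a b h => (List.cons.inj h).1,
    Finset.card_range]

lemma mem_frontier {y : List ℕ} : y ∈ frontier F ↔ y ∉ F ∧ y ≠ [] ∧ prevBirth y ∈ F := by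
  simp only [frontier, Finset.mem_image]
  constructor
  · rintro ⟨x, hx, rfl⟩
    refine ⟨by simp [hF.cons_mem_iff], by simp, ?_⟩
    cases h : childCount F x with
    | zero => exact hx
    | succ c => exact (hF.cons_mem_iff c x).2 (by omega)
  · rintro ⟨h1, h2, h3⟩
    match y, h2 with
    | 0 :: x, _ =>
      refine ⟨x, h3, ?_⟩
      rw [hF.cons_mem_iff] at h1
      congr 1; omega
    | (j + 1) :: x, _ =>
      have h3 : j :: x ∈ F := h3
      refine ⟨x, hF.parent_mem h3, ?_⟩
      rw [hF.cons_mem_iff] at h1 h3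
      congr 1; omega

lemma insert {z : List ℕ} (hz : z ∈ frontier F) : Explored (insert z F) := by
  refine ⟨Finset.mem_insert_of_mem hF.nil_mem, fun y hy => ?_⟩
  rcases Finset.mem_insert.1 hy with rfl | hy
  · exact Finset.mem_insert_of_mem (hF.mem_frontier.1 hz).2.2
  · exact Finset.mem_insert_of_mem (hF.prevBirth_mem y hy)

/-- The next birth occurs on the frontier. -/
lemma exists_frontier_le {e : List ℕ → ℝ} (he : ∀ y, y ≠ [] → 0 < e y) {y : List ℕ}
    (hy : y ∉ F) : ∃ z ∈ frontier F, z = y ∨ bornAt e z < bornAt e y := by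
  revert hy
  induction y using prevBirth_induction with
  | nil => exact fun h => absurd hF.nil_mem h
  | step y hy ih =>
    intro hyF
    by_cases hp : prevBirth y ∈ F
    · exact ⟨y, hF.mem_frontier.2 ⟨hyF, hy, hp⟩, Or.inl rfl⟩
    · obtain ⟨z, hz, h⟩ := ih hp
      refine ⟨z, hz, Or.inr ?_⟩
      have h1 := bornAt_eq e hy
      have h2 := he y hy
      rcases h with rfl | h
      · linarith
      · linarith

lemma frontier_nonempty : (frontier F).Nonempty :=
  ⟨_, Finset.mem_image_of_mem _ hF.nil_mem⟩

-- Each member of `F` contributes exactly one candidate, its next child. A race on the frontier is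
-- thus a choice of a parent in `F`.
omit hF in
lemma sum_frontier (f : List ℕ → ℝ) :
    ∑ y ∈ frontier F, f y = ∑ x ∈ F, f (childCount F x :: x) :=
  Finset.sum_image fun _ _ _ _ h => (List.cons.inj h).2

end Explored

/-- The first `n` members of the sequence `v`. -/
def firsts (v : ℕ → List ℕ) (n : ℕ) : Finset (List ℕ) := (Finset.range n).image v

/-- `v` starts with a possible order of the first `n` births. -/
structure IsBirthOrder (v : ℕ → List ℕ) (n : ℕ) : Prop where
  zero : v 0 = []
  mem_frontier : ∀ k, 1 ≤ k → k < n → v k ∈ frontier (firsts v k)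

/-- For the clocks `e`, the first `n` births occur in the order `v`. -/
def Realizes (e : List ℕ → ℝ) (v : ℕ → List ℕ) (n : ℕ) : Prop :=
  ∀ k, 1 ≤ k → k < n → ∀ y ∈ frontier (firsts v k), y ≠ v k → bornAt e (v k) < bornAt e y

lemma firsts_succ (v : ℕ → List ℕ) (n : ℕ) : firsts v (n + 1) = insert (v n) (firsts v n) := by
  rw [firsts, Finset.range_add_one, Finset.image_insert, firsts]

lemma firsts_mono (v : ℕ → List ℕ) : Monotone (firsts v) := fun _ _ h =>
  Finset.image_subset_image (Finset.range_mono h)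

lemma mem_firsts {v : ℕ → List ℕ} {n : ℕ} {y : List ℕ} :
    y ∈ firsts v n ↔ ∃ k < n, v k = y := by
  simp [firsts]

lemma firsts_congr {v w : ℕ → List ℕ} {n : ℕ} (h : ∀ k < n, v k = w k) :
    firsts v n = firsts w n :=
  Finset.image_congr fun k hk => h k (by simpa using hk)

lemma IsBirthOrder.mono {v : ℕ → List ℕ} {m n : ℕ} (h : IsBirthOrder v n) (hmn : m ≤ n) :
    IsBirthOrder v m :=
  ⟨h.zero, fun k h1 h2 => h.mem_frontier k h1 (h2.trans_le hmn)⟩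

lemma Realizes.mono {e : List ℕ → ℝ} {v : ℕ → List ℕ} {m n : ℕ} (h : Realizes e v n)
    (hmn : m ≤ n) : Realizes e v m :=
  fun k h1 h2 => h k h1 (h2.trans_le hmn)

lemma IsBirthOrder.congr {v w : ℕ → List ℕ} {n : ℕ} (hv : IsBirthOrder v n) (hn : 1 ≤ n)
    (h : ∀ k < n, v k = w k) : IsBirthOrder w n := by
  refine ⟨by rw [← h 0 hn]; exact hv.zero, fun k h1 h2 => ?_⟩
  rw [← h k h2, ← firsts_congr fun i hi => h i (hi.trans h2)]
  exact hv.mem_frontier k h1 h2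

lemma Realizes.congr {e : List ℕ → ℝ} {v w : ℕ → List ℕ} {n : ℕ} (hv : Realizes e v n)
    (h : ∀ k < n, v k = w k) : Realizes e w n := by
  intro k h1 h2
  rw [← h k h2, ← firsts_congr fun i hi => h i (hi.trans h2)]
  exact hv k h1 h2

lemma IsBirthOrder.explored {v : ℕ → List ℕ} {n : ℕ} (hv : IsBirthOrder v n) (hn : 1 ≤ n) :
    Explored (firsts v n) := by
  induction n, hn using Nat.le_induction with
  | base =>
    have : firsts v 1 = {[]} := by simp [firsts, hv.zero]
    rw [this]
    exact ⟨by simp, fun y hy => by rw [Finset.mem_singleton.1 hy]; simp [prevBirth]⟩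
  | succ n hn ih =>
    rw [firsts_succ]
    exact (ih (hv.mono (Nat.le_succ n))).insert (hv.mem_frontier n hn (Nat.lt_succ_self n))

lemma IsBirthOrder.notMem_firsts {v : ℕ → List ℕ} {n k : ℕ} (hv : IsBirthOrder v n) (hk : k < n) :
    v k ∉ firsts v k := by
  rcases Nat.eq_zero_or_pos k with rfl | h1
  · simp [firsts]
  · exact ((hv.mono hk.le).explored h1).mem_frontier.1 (hv.mem_frontier k h1 hk) |>.1

lemma IsBirthOrder.injOn {v : ℕ → List ℕ} {n : ℕ} (hv : IsBirthOrder v n) :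
    Set.InjOn v (Set.Iio n) := by
  have key : ∀ i j, i < j → j < n → v i ≠ v j := fun i j hij hj h =>
    hv.notMem_firsts hj (mem_firsts.2 ⟨i, hij, h⟩)
  intro i hi j hj h
  rcases lt_trichotomy i j with h' | h' | h'
  · exact absurd h (key i j h' hj)
  · exact h'
  · exact absurd h.symm (key j i h' hi)

/-- In a realized order, the `k`-th individual is born before all the later ones. -/
lemma IsBirthOrder.bornAt_lt {e : List ℕ → ℝ} (he : ∀ y, y ≠ [] → 0 < e y) {v : ℕ → List ℕ}
    {n : ℕ} (hv : IsBirthOrder v n) (h : Realizes e v n) {k : ℕ} (hk : k < n) {y : List ℕ}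
    (hy : y ∉ firsts v (k + 1)) : bornAt e (v k) < bornAt e y := by
  -- `Realizes` is silent about `k = 0`; the root comes first because all clocks are positive.
  rcases Nat.eq_zero_or_pos k with rfl | h1
  · have pos : ∀ y, y ≠ [] → 0 < bornAt e y := by
      intro y
      induction y using prevBirth_induction with
      | nil => exact fun h => absurd rfl h
      | step y hy ih =>
        intro _
        rw [bornAt_eq e hy]
        have := he y hy
        by_cases hp : prevBirth y = []
        · rw [hp, bornAt]; linarith
        · have := ih hp; linarith
    rw [hv.zero]
    refine pos y fun h => hy (mem_firsts.2 ⟨0, by omega, by rw [hv.zero, h]⟩)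
  · rw [firsts_succ, Finset.mem_insert, not_or] at hy
    obtain ⟨z, hz, hzy⟩ := ((hv.mono hk.le).explored h1).exists_frontier_le he hy.2
    by_cases hzk : z = v k
    · subst hzk
      rcases hzy with rfl | hzy
      · exact absurd rfl hy.1
      · exact hzy
    · have := h k h1 hk z hz hzk
      rcases hzy with rfl | hzy
      · exact this
      · exact this.trans hzy

/-! ### Residual clocks along a fixed order of births -/

/-- The residual clocks at the time of the `n`-th birth. -/
def residual (v : ℕ → List ℕ) (n : ℕ) (e : List ℕ → ℝ) (y : List ℕ) : ℝ :=
  -- Indices start at `0`, so `v (n - 1)` is the `n`-th individual. Off the frontier the clock of an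
  -- unborn individual has not started.
  if y ∈ frontier (firsts v n) then bornAt e y - bornAt e (v (n - 1)) else e y

section Clocks

variable {Ω : Type*} [MeasurableSpace Ω] {P : Measure Ω} {r : List ℕ → ℝ} {E : List ℕ → Ω → ℝ}

lemma IndepExp.congr {Q : Measure Ω} {U V : Set (List ℕ)} {Z Z' : List ℕ → Ω → ℝ}
    (h : IndepExp Q U r Z) (hUV : V ⊆ U) (hZ : ∀ y ∈ V, ∀ ω, Z y ω = Z' y ω) :
    IndepExp Q V r Z' := by
  intro S hS B hB
  rw [← h S (hS.trans hUV) B hB]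
  congr 1
  ext ω
  simp only [Set.mem_iInter, Set.mem_preimage]
  exact forall₂_congr fun y hy => by rw [hZ y (hS hy)]

lemma measurable_residual (hE : ∀ y, Measurable (E y)) (v : ℕ → List ℕ) (n : ℕ) (y : List ℕ) :
    Measurable fun ω => residual v n (E · ω) y := by
  unfold residual
  split_ifs
  · exact (measurable_bornAt hE _).sub (measurable_bornAt hE _)
  · exact hE y

lemma measurableSet_realizes (hE : ∀ y, Measurable (E y)) (v : ℕ → List ℕ) (n : ℕ) :
    MeasurableSet {ω | Realizes (E · ω) v n} := by
  have : {ω | Realizes (E · ω) v n} = ⋂ k, ⋂ (_ : 1 ≤ k), ⋂ (_ : k < n),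
      ⋂ y ∈ frontier (firsts v k), ⋂ (_ : y ≠ v k),
        {ω | bornAt (E · ω) (v k) < bornAt (E · ω) y} := by
    ext ω; simp [Realizes]
  rw [this]
  refine .iInter fun k => .iInter fun _ => .iInter fun _ => Finset.measurableSet_biInter _
    fun y _ => .iInter fun _ => ?_
  exact measurableSet_lt (measurable_bornAt hE _) (measurable_bornAt hE _)

-- All candidates are compared after subtracting the same time, that of the last birth, so the
-- earliest birth is the smallest residual.
omit [MeasurableSpace Ω] in
lemma setOf_realizes_succ {v : ℕ → List ℕ} {n : ℕ} (hn : 1 ≤ n) (hv : IsBirthOrder v (n + 1)) :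
    {ω | Realizes (E · ω) v (n + 1)} = {ω | Realizes (E · ω) v n} ∩
      ringsFirst (fun y ω => residual v n (E · ω) y) (frontier (firsts v n)) (v n) := by
  ext ω
  simp only [Set.mem_ofPred_eq, Set.mem_inter_iff, ringsFirst]
  have hvn := hv.mem_frontier n hn (Nat.lt_succ_self n)
  have e : ∀ y ∈ frontier (firsts v n), residual v n (E · ω) y
      = bornAt (E · ω) y - bornAt (E · ω) (v (n - 1)) := fun y hy => if_pos hy
  constructor
  · intro h
    refine ⟨h.mono (Nat.le_succ n), fun y hy hyn => ?_⟩
    rw [e y hy, e _ hvn]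
    exact sub_lt_sub_right (h n hn (Nat.lt_succ_self n) y hy hyn) _
  · rintro ⟨h1, h2⟩ k hk1 hk2 y hy hyk
    rcases Nat.lt_succ_iff_lt_or_eq.1 hk2 with hk | rfl
    · exact h1 k hk1 hk y hy hyk
    · have := h2 y hy hyk
      rw [e y hy, e _ hvn] at this
      exact (sub_lt_sub_iff_right _).1 this

/-- A clock already on the frontier keeps running and loses the time of the last race. A clock that
enters the frontier has `v n` as its predecessor, so it starts now with its full length. Other
clocks have not started. This is the update made by `clockAfter`. -/
lemma residual_succ {v : ℕ → List ℕ} {n : ℕ} (hn : 1 ≤ n) (hv : IsBirthOrder v (n + 1))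
    (e : List ℕ → ℝ) {y : List ℕ} (hy : y ∉ firsts v (n + 1)) :
    residual v (n + 1) e y = if y ∈ frontier (firsts v n) then
      residual v n e y - residual v n e (v n) else residual v n e y := by
  have hvn := hv.mem_frontier n hn (Nat.lt_succ_self n)
  have hF := (hv.mono (Nat.le_succ n)).explored hn
  have hF' := hv.explored (Nat.succ_le_succ (Nat.zero_le n))
  rw [firsts_succ, Finset.mem_insert, not_or] at hy
  by_cases h1 : y ∈ frontier (firsts v n)
  · have h2 : y ∈ frontier (firsts v (n + 1)) := by
      have := hF.mem_frontier.1 h1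
      refine hF'.mem_frontier.2 ⟨?_, this.2.1, ?_⟩
      · rw [firsts_succ, Finset.mem_insert, not_or]; exact hy
      · rw [firsts_succ]; exact Finset.mem_insert_of_mem this.2.2
    rw [if_pos h1, residual, residual, residual, if_pos h1, if_pos hvn, if_pos h2,
      Nat.add_sub_cancel]
    ring
  · rw [if_neg h1, residual, residual, if_neg h1]
    split_ifs with h2
    · have h3 := hF'.mem_frontier.1 h2
      have h4 : prevBirth y = v n := by
        have := h3.2.2
        rw [firsts_succ, Finset.mem_insert] at this
        refine this.resolve_right fun h => h1 (hF.mem_frontier.2 ⟨hy.2, h3.2.1, h⟩)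
      rw [bornAt_eq e h3.2.1, h4, Nat.add_sub_cancel]
      ring
    · rfl

variable [IsProbabilityMeasure P]

/-- Given the order of the first `n` births, the residual clocks are independent and exponential. -/
lemma IndepExp.cond_realizes (h : IndepExp P {y | y ≠ []} r E) (hE : ∀ y, Measurable (E y))
    (hr : ∀ y, y ≠ [] → 0 < r y) {v : ℕ → List ℕ} {n : ℕ} (hn : 1 ≤ n) (hv : IsBirthOrder v n) :
    P {ω | Realizes (E · ω) v n} ≠ 0 ∧
      IndepExp P[|{ω | Realizes (E · ω) v n}] {y | y ∉ firsts v n} r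
        fun y ω => residual v n (E · ω) y := by
  induction n, hn using Nat.le_induction with
  | base =>
    have h1 : {ω | Realizes (E · ω) v 1} = Set.univ := by
      ext ω
      simp only [Set.mem_ofPred_eq, Set.mem_univ, iff_true]
      intro k h1 h2; omega
    rw [h1, cond_univ]
    refine ⟨by simp, h.congr (fun y hy hy' => hy (mem_firsts.2 ⟨0, one_pos, ?_⟩))
      fun y hy ω => ?_⟩
    · rw [hv.zero]; exact hy'.symm
    · have hF := hv.explored le_rfl
      rw [residual]
      split_ifs with h2
      · have h3 := hF.mem_frontier.1 h2
        obtain ⟨k, hk, hk'⟩ := mem_firsts.1 h3.2.2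
        obtain rfl : k = 0 := by omega
        rw [bornAt_eq _ h3.2.1, ← hk']
        simp
      · rfl
  | succ n hn ih =>
    obtain ⟨h0, hQ⟩ := ih (hv.mono (Nat.le_succ n))
    have := cond_isProbabilityMeasure h0
    have hF := (hv.mono (Nat.le_succ n)).explored hn
    have hvn := hv.mem_frontier n hn (Nat.lt_succ_self n)
    have hZ := measurable_residual hE v n
    have hU : ∀ y ∈ {y | y ∉ firsts v n}, 0 < r y := fun y hy =>
      hr y fun hy' => hy (hy' ▸ hF.nil_mem)
    have hA : (frontier (firsts v n) : Set (List ℕ)) ⊆ {y | y ∉ firsts v n} := fun y hy =>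
      (hF.mem_frontier.1 hy).1
    have hm := measurableSet_realizes hE v n
    have hW := measurableSet_ringsFirst hZ (frontier (firsts v n)) (v n)
    rw [setOf_realizes_succ hn hv]
    constructor
    · have h1 := hQ.measure_ringsFirst hZ hU hA hvn
      rw [cond_apply hm] at h1
      intro h2
      rw [h2, mul_zero] at h1
      have h3 : 0 < ∑ j ∈ frontier (firsts v n), r j :=
        Finset.sum_pos (fun j hj => hU j (hA hj)) ⟨_, hvn⟩
      exact (ENNReal.ofReal_pos.2 (div_pos (hU _ (hA hvn)) h3)).ne h1
    · rw [← cond_cond_eq_cond_inter hm hW]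
      refine (hQ.cond_ringsFirst hZ hU hA hvn).congr (fun y hy => ?_) fun y hy ω => ?_
      · have hy : y ∉ firsts v (n + 1) := hy
        rw [firsts_succ, Finset.mem_insert, not_or] at hy
        exact ⟨hy.2, hy.1⟩
      · rw [residual_succ hn hv _ hy, clockAfter]
        split_ifs <;> rfl

/-- The next individual to be born is chosen on the frontier with probability proportional to the
rate of its clock. -/
lemma IndepExp.measure_realizes_succ (h : IndepExp P {y | y ≠ []} r E)
    (hE : ∀ y, Measurable (E y)) (hr : ∀ y, y ≠ [] → 0 < r y) {v : ℕ → List ℕ} {n : ℕ}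
    (hn : 1 ≤ n) (hv : IsBirthOrder v (n + 1)) :
    P {ω | Realizes (E · ω) v (n + 1)} = P {ω | Realizes (E · ω) v n} *
      ENNReal.ofReal (r (v n) / ∑ y ∈ frontier (firsts v n), r y) := by
  obtain ⟨h0, hQ⟩ := h.cond_realizes hE hr hn (hv.mono (Nat.le_succ n))
  have := cond_isProbabilityMeasure h0
  have hF := (hv.mono (Nat.le_succ n)).explored hn
  have hA : (frontier (firsts v n) : Set (List ℕ)) ⊆ {y | y ∉ firsts v n} := fun y hy =>
    (hF.mem_frontier.1 hy).1
  rw [← hQ.measure_ringsFirst (measurable_residual hE v n)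
    (fun y hy => hr y fun hy' => hy (hy' ▸ hF.nil_mem)) hA
    (hv.mem_frontier n hn (Nat.lt_succ_self n)), setOf_realizes_succ hn hv,
    cond_apply (measurableSet_realizes hE v n), ← mul_assoc,
    ENNReal.mul_inv_cancel h0 (measure_ne_top _ _), one_mul]

end Clocks

/-! ### The tree in terms of the order of births -/

/-- The clocks of the births, for given reproduction paths. -/
noncomputable def birthClock (X : List ℕ → ℝ≥0 → ℕ) : List ℕ → ℝ
  | [] => 0
  | j :: x => holdTime (X x) j

/-- Reproduction paths that jump by one at a time, and have infinitely many jumps. -/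
structure IsRegularFamily (X : List ℕ → ℝ≥0 → ℕ) : Prop where
  path : ∀ x, IsCountingPath (X x)
  ne_top : ∀ x k, reachTime (X x) k ≠ ⊤
  lt_succ : ∀ x k, reachTime (X x) k < reachTime (X x) (k + 1)

namespace IsRegularFamily

variable {X : List ℕ → ℝ≥0 → ℕ} (hX : IsRegularFamily X)
include hX

lemma birthClock_pos (y : List ℕ) (hy : y ≠ []) : 0 < birthClock X y := by
  match y, hy with
  | j :: x, _ =>
    exact sub_pos.2 ((ENNReal.toReal_lt_toReal (hX.ne_top x j) (hX.ne_top x (j + 1))).2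
      (hX.lt_succ x j))

/-- The holding times of a path telescope to its passage times, starting from `reachTime _ 0 = 0`.
-/
lemma birthTime_eq (y : List ℕ) :
    0 ≤ bornAt (birthClock X) y ∧
      birthTime X y = ENNReal.ofReal (bornAt (birthClock X) y) := by
  induction y with
  | nil => simp [bornAt, birthTime]
  | cons j x ih =>
    have h1 : ∑ i ∈ Finset.range (j + 1), birthClock X (i :: x)
        = (reachTime (X x) (j + 1)).toReal := by
      have := Finset.sum_range_sub (fun i => (reachTime (X x) i).toReal) (j + 1)
      rw [(hX.path x).reachTime_zero, ENNReal.toReal_zero, sub_zero] at this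
      exact this
    rw [bornAt, birthTime, h1, (hX.path x).childAge_eq, ih.2]
    refine ⟨add_nonneg ih.1 ENNReal.toReal_nonneg, ?_⟩
    rw [ENNReal.ofReal_add ih.1 ENNReal.toReal_nonneg, ENNReal.ofReal_toReal (hX.ne_top _ _)]

end IsRegularFamily

/-- The first `n` individuals to be born are `v 0, …, v (n - 1)`, in this order. -/
def BornFirst (T : List ℕ → ℝ≥0∞) (v : ℕ → List ℕ) (n : ℕ) : Prop :=
  ∀ k < n, ∀ y ∉ firsts v (k + 1), T (v k) < T y

lemma IsRegularFamily.bornFirst {X : List ℕ → ℝ≥0 → ℕ} (hX : IsRegularFamily X)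
    {v : ℕ → List ℕ} {n : ℕ} (hv : IsBirthOrder v n) (h : Realizes (birthClock X) v n) :
    BornFirst (birthTime X) v n := by
  intro k hk y hy
  have := hv.bornAt_lt hX.birthClock_pos h hk hy
  rw [(hX.birthTime_eq _).2, (hX.birthTime_eq _).2]
  exact (ENNReal.ofReal_lt_ofReal_iff ((hX.birthTime_eq _).1.trans_lt this)).2 this

lemma IsBirthOrder.card_firsts {v : ℕ → List ℕ} {n k : ℕ} (hv : IsBirthOrder v n) (hk : k ≤ n) :
    (firsts v k).card = k := by
  rw [firsts, Finset.card_image_of_injOn, Finset.card_range]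
  exact hv.injOn.mono fun i hi => (Finset.mem_range.1 hi).trans_le hk

lemma IsBirthOrder.notMem_firsts_succ {v : ℕ → List ℕ} {n i k : ℕ} (hv : IsBirthOrder v n)
    (hik : i < k) (hk : k < n) : v k ∉ firsts v (i + 1) := fun h =>
  hv.notMem_firsts hk (firsts_mono v hik h)

namespace BornFirst

variable {T : List ℕ → ℝ≥0∞} {v : ℕ → List ℕ} {n : ℕ} (h : BornFirst T v n)
  (hv : IsBirthOrder v n)
include h

lemma mono {m : ℕ} (hmn : m ≤ n) : BornFirst T v m := fun k hk => h k (hk.trans_le hmn)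

lemma lt_top {k : ℕ} (hk : k < n) : T (v k) < ⊤ := by
  -- Any individual outside the list has a strictly larger birth time, which makes this one finite.
  obtain ⟨y, hy⟩ := Infinite.exists_notMem_finset (firsts v (k + 1))
  exact (h k hk y hy).trans_le le_top

include hv

lemma setOf_lt {k : ℕ} (hk : k < n) : {y | T y < T (v k)} = firsts v k := by
  ext y
  simp only [Set.mem_ofPred_eq, Finset.mem_coe]
  constructor
  · intro hy
    by_contra hyk
    by_cases hyv : y = v k
    · rw [hyv] at hy; exact lt_irrefl _ hy
    · refine lt_asymm hy (h k hk y ?_)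
      rw [firsts_succ, Finset.mem_insert, not_or]
      exact ⟨hyv, hyk⟩
  · intro hy
    obtain ⟨i, hi, rfl⟩ := mem_firsts.1 hy
    exact h i (hi.trans hk) _ (hv.notMem_firsts_succ hi hk)

lemma setOf_le {k : ℕ} (hk : k < n) : {y | T y ≤ T (v k)} = firsts v (k + 1) := by
  ext y
  simp only [Set.mem_ofPred_eq, Finset.mem_coe]
  constructor
  · intro hy
    by_contra hyk
    exact absurd (h k hk y hyk) (not_lt.2 hy)
  · intro hy
    rw [firsts_succ, Finset.mem_insert] at hy
    rcases hy with rfl | hy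
    · exact le_rfl
    · have : y ∈ {y | T y < T (v k)} := by rw [h.setOf_lt hv hk]; exact hy
      exact le_of_lt this

lemma injOn : Set.InjOn T (firsts v n) := by
  have key : ∀ i j, i < j → j < n → T (v i) < T (v j) := fun i j hij hj =>
    h i (hij.trans hj) _ (hv.notMem_firsts_succ hij hj)
  intro x hx y hy hxy
  obtain ⟨i, hi, rfl⟩ := mem_firsts.1 hx
  obtain ⟨j, hj, rfl⟩ := mem_firsts.1 hy
  rcases lt_trichotomy i j with h' | rfl | h'
  · exact absurd hxy (key i j h' hj).ne
  · rfl
  · exact absurd hxy (key j i h' hi).ne'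

end BornFirst

section Tree

variable {X : List ℕ → ℝ≥0 → ℕ} {v : ℕ → List ℕ} {n : ℕ}

/-- At the birth of `v n` the tree has exactly `n + 1` members; at any earlier time it lies in
`firsts v n`, which has only `n`. -/
lemma BornFirst.hittingTime_eq (h : BornFirst (birthTime X) v (n + 1))
    (hv : IsBirthOrder v (n + 1)) : hittingTime X (n + 1) = birthTime X (v n) := by
  induction n with
  | zero => rw [hittingTime, hv.zero, birthTime]
  | succ n ih =>
    have ih := ih (h.mono (Nat.le_succ _)) (hv.mono (Nat.le_succ _))
    have hlt : n + 1 < n + 1 + 1 := Nat.lt_succ_self _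
    have htop := h.lt_top hlt
    rw [hittingTime]
    refine le_antisymm ?_ (le_iInf₂ fun t ht => ?_)
    · refine (iInf₂_le (birthTime X (v (n + 1))).toNNReal ⟨?_, ?_⟩).trans
        (ENNReal.coe_toNNReal htop.ne).le
      · rw [ENNReal.coe_toNNReal htop.ne, ih]
        exact (h n (by omega) _ (hv.notMem_firsts_succ (Nat.lt_succ_self n) hlt)).le
      · rw [ENNReal.coe_toNNReal htop.ne, tree, h.setOf_le hv hlt, Set.encard_coe_eq_coe_finsetCard,
          hv.card_firsts le_rfl]
    · by_contra hlt'
      push Not at hlt'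
      have hsub : tree X t ⊆ firsts v (n + 1) := by
        rw [← h.setOf_lt hv hlt]
        exact fun y hy => lt_of_le_of_lt hy hlt'
      have h1 := Set.encard_le_encard hsub
      rw [ht.2, Set.encard_coe_eq_coe_finsetCard, hv.card_firsts (Nat.le_succ _)] at h1
      have : n + 2 ≤ n + 1 := by exact_mod_cast h1
      omega

lemma BornFirst.tree_eq (h : BornFirst (birthTime X) v n) (hv : IsBirthOrder v n) (hn : 1 ≤ n) :
    tree X (hittingTime X n) = firsts v n := by
  obtain ⟨m, rfl⟩ := Nat.exists_eq_add_of_le' hn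
  rw [h.hittingTime_eq hv, tree, h.setOf_le hv (Nat.lt_succ_self m)]

lemma BornFirst.hasBirthRank_iff (h : BornFirst (birthTime X) v n) (hv : IsBirthOrder v n) {k : ℕ}
    (hk : k < n) (i : ℕ) : HasBirthRank X (v k) i ↔ k = i := by
  rw [HasBirthRank, h.setOf_lt hv hk, Set.encard_coe_eq_coe_finsetCard, hv.card_firsts hk.le]
  exact Nat.cast_inj

/-- The parent-child graph of the first `n` members of `v`. -/
def orderGraph (v : ℕ → List ℕ) (n : ℕ) : SimpleGraph (Fin n) :=
  SimpleGraph.fromRel fun a b => IsChild (v a) (v b)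

lemma BornFirst.treeGraph_eq (h : BornFirst (birthTime X) v n) (hv : IsBirthOrder v n)
    (hn : 1 ≤ n) : treeGraph X n = orderGraph v n := by
  unfold treeGraph orderGraph
  congr 1
  ext a b
  rw [h.tree_eq hv hn]
  constructor
  · rintro ⟨x, hx, y, hy, hxa, hyb, hc⟩
    obtain ⟨i, hi, rfl⟩ := mem_firsts.1 (Finset.mem_coe.1 hx)
    obtain ⟨j, hj, rfl⟩ := mem_firsts.1 (Finset.mem_coe.1 hy)
    rw [h.hasBirthRank_iff hv hi] at hxa
    rw [h.hasBirthRank_iff hv hj] at hyb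
    rwa [← hxa, ← hyb]
  · intro hc
    exact ⟨v a, mem_firsts.2 ⟨a, a.2, rfl⟩, v b, mem_firsts.2 ⟨b, b.2, rfl⟩,
      (h.hasBirthRank_iff hv a.2 _).2 rfl, (h.hasBirthRank_iff hv b.2 _).2 rfl, hc⟩

end Tree

/-! ### The parent-child graph -/

section OrderGraph

variable {v : ℕ → List ℕ} {n : ℕ}

lemma orderGraph_congr {w : ℕ → List ℕ} (h : ∀ k < n, v k = w k) :
    orderGraph v n = orderGraph w n := by
  unfold orderGraph
  congr 1
  ext a b
  rw [h a a.2, h b b.2]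

lemma IsChild.length_eq {x y : List ℕ} (h : IsChild x y) : y.length = x.length + 1 := by
  obtain ⟨j, rfl⟩ := h
  rfl

lemma orderGraph_adj (a b : Fin n) :
    (orderGraph v n).Adj a b ↔ IsChild (v a) (v b) ∨ IsChild (v b) (v a) := by
  rw [orderGraph, SimpleGraph.fromRel_adj]
  refine and_iff_right_of_imp ?_
  rintro (h | h) rfl <;> simpa using h.length_eq

/-- The newcomer is joined to its parent only: it is not the parent of an earlier individual, since
parents come before their children. -/
lemma IsBirthOrder.orderGraph_succ (hv : IsBirthOrder v (n + 1)) (hn : 1 ≤ n) {i : Fin n}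
    (hi : IsChild (v i) (v n)) : orderGraph v (n + 1) = attach (orderGraph v n) i := by
  have hF := (hv.mono (Nat.le_succ n)).explored hn
  have hvn := hv.notMem_firsts (Nat.lt_succ_self n)
  have key : ∀ b : Fin n, (IsChild (v b) (v n) ∨ IsChild (v n) (v b)) ↔ b = i := by
    intro b
    constructor
    · rintro (⟨j, hj⟩ | ⟨j, hj⟩)
      · obtain ⟨j', hj'⟩ := hi
        rw [hj'] at hj
        have := (List.cons.inj hj).2
        exact Fin.ext (hv.injOn (b.2.trans (Nat.lt_succ_self n)) (i.2.trans (Nat.lt_succ_self n))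
          this.symm)
      · exact absurd (hF.parent_mem (mem_firsts.2 ⟨b, b.2, hj⟩)) hvn
    · rintro rfl; exact Or.inl hi
  ext a b
  rw [orderGraph_adj, attach, SimpleGraph.sup_adj, SimpleGraph.map_adj]
  induction a using Fin.lastCases with
  | last =>
    induction b using Fin.lastCases with
    | last =>
      simp only [Fin.val_last, or_self, SimpleGraph.irrefl, or_false]
      constructor
      · intro h; simpa using h.length_eq
      · rintro ⟨c, d, -, hc, -⟩
        exact absurd hc (Fin.castSucc_lt_last c).ne
    | cast b =>
      have h1 : ¬ ∃ c d, (orderGraph v n).Adj c d ∧ Fin.castSuccEmb c = Fin.last n ∧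
          Fin.castSuccEmb d = b.castSucc := by
        rintro ⟨c, d, -, hc, -⟩
        exact absurd hc (Fin.castSucc_lt_last c).ne
      simp only [Fin.val_last, Fin.val_castSucc, h1, false_or]
      rw [or_comm, key, SimpleGraph.edge_adj]
      have h2 := (Fin.castSucc_lt_last b).ne
      have h3 := (Fin.castSucc_lt_last i).ne
      simp only [h2, h2.symm, h3.symm, Fin.castSucc_inj, true_and, false_and, and_true, false_or,
        ne_eq, not_false_eq_true]
  | cast a =>
    induction b using Fin.lastCases with
    | last =>
      have h1 : ¬ ∃ c d, (orderGraph v n).Adj c d ∧ Fin.castSuccEmb c = a.castSucc ∧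
          Fin.castSuccEmb d = Fin.last n := by
        rintro ⟨c, d, -, -, hc⟩
        exact absurd hc (Fin.castSucc_lt_last d).ne
      simp only [Fin.val_last, Fin.val_castSucc, h1, false_or]
      rw [key, SimpleGraph.edge_adj]
      have h2 := (Fin.castSucc_lt_last a).ne
      have h3 := (Fin.castSucc_lt_last i).ne
      simp only [h2, h3.symm, Fin.castSucc_inj, and_true, and_false, or_false,
        ne_eq, not_false_eq_true]
    | cast b =>
      have h2 := (Fin.castSucc_lt_last a).ne
      have h3 := (Fin.castSucc_lt_last b).ne
      have h1 : ¬ (SimpleGraph.edge i.castSucc (Fin.last n)).Adj a.castSucc b.castSucc := by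
        rw [SimpleGraph.edge_adj]
        simp [h2, h3]
      simp only [Fin.val_castSucc, h1, or_false, ← orderGraph_adj]
      constructor
      · intro h; exact ⟨a, b, h, rfl, rfl⟩
      · rintro ⟨c, d, h, hc, hd⟩
        rwa [← Fin.castSucc_injective n hc, ← Fin.castSucc_injective n hd]

lemma attach_injective (g : SimpleGraph (Fin n)) : Function.Injective (attach g) := by
  intro i i' h
  have h1 : (attach g i).Adj i.castSucc (Fin.last n) := by
    rw [attach, SimpleGraph.sup_adj, SimpleGraph.edge_adj]
    exact Or.inr ⟨Or.inl ⟨rfl, rfl⟩, (Fin.castSucc_lt_last i).ne⟩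
  rw [h, attach, SimpleGraph.sup_adj, SimpleGraph.edge_adj, SimpleGraph.map_adj] at h1
  have h2 := (Fin.castSucc_lt_last i).ne
  rcases h1 with ⟨c, d, -, -, hd⟩ | ⟨⟨h3, -⟩ | ⟨h3, -⟩, -⟩
  · exact absurd hd (Fin.castSucc_lt_last d).ne
  · exact Fin.castSucc_injective n h3
  · exact absurd h3 h2

/-- The neighbours are the children and the parent. The root has no parent, and its half edge makes
up for the missing one. -/
lemma IsBirthOrder.degree_eq (hv : IsBirthOrder v n) (a : Fin n) :
    degree (orderGraph v n) a = childCount (firsts v n) (v a) + 1 := by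
  have hn : 1 ≤ n := by have := a.2; omega
  have hF := hv.explored hn
  have hinj : Function.Injective fun b : Fin n => v b := fun b c h =>
    Fin.ext (hv.injOn b.2 c.2 h)
  have e : (orderGraph v n).neighborSet a
      = {b : Fin n | IsChild (v a) (v b)} ∪ {b : Fin n | IsChild (v b) (v a)} := by
    ext b
    rw [SimpleGraph.mem_neighborSet, orderGraph_adj]
    rfl
  have hd : Disjoint {b : Fin n | IsChild (v a) (v b)} {b : Fin n | IsChild (v b) (v a)} := by
    refine Set.disjoint_left.2 fun b h1 h2 => ?_
    have h1 := IsChild.length_eq h1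
    have h2 := IsChild.length_eq h2
    omega
  have hC : {b : Fin n | IsChild (v a) (v b)}.ncard = childCount (firsts v n) (v a) := by
    rw [childCount, ← Set.ncard_coe_finset, ← Set.ncard_image_of_injective _ hinj]
    congr 1
    ext y
    simp only [Set.mem_image, Set.mem_ofPred_eq, Finset.coe_filter, mem_firsts]
    constructor
    · rintro ⟨b, ⟨j, hj⟩, rfl⟩
      exact ⟨⟨b, b.2, rfl⟩, by simp [hj], by simp [hj]⟩
    · rintro ⟨⟨k, hk, rfl⟩, h1, h2⟩
      refine ⟨⟨k, hk⟩, ?_, rfl⟩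
      rw [← h2]
      exact ⟨(v k).head h1, (List.cons_head_tail h1).symm⟩
  rw [degree, e, Set.ncard_union_eq hd, hC, add_assoc]
  congr 1
  by_cases h0 : (a : ℕ) = 0
  · have : {b : Fin n | IsChild (v b) (v a)} = ∅ := by
      ext b
      simp only [Set.mem_ofPred_eq, Set.mem_empty_iff_false, iff_false]
      rintro ⟨j, hj⟩
      rw [h0, hv.zero] at hj
      simp at hj
    rw [this, if_pos h0, Set.ncard_empty]
  · rw [if_neg h0, add_zero, Set.ncard_eq_one]
    have hva : v a ∈ firsts v n := mem_firsts.2 ⟨a, a.2, rfl⟩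
    have hne : v a ≠ [] := fun h => h0 (hv.injOn a.2 (Set.mem_Iio.2 hn) (by rw [h, hv.zero]))
    have hcons := List.cons_head_tail hne
    rw [← hcons] at hva
    obtain ⟨k, hk, hk'⟩ := mem_firsts.1 (hF.parent_mem hva)
    refine ⟨⟨k, hk⟩, ?_⟩
    ext b
    simp only [Set.mem_ofPred_eq, Set.mem_singleton_iff]
    constructor
    · rintro ⟨j, hj⟩
      rw [← hcons] at hj
      refine hinj ?_
      simp only [hk']
      exact (List.cons.inj hj).2.symm
    · rintro rfl
      refine ⟨(v a).head hne, ?_⟩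
      rw [hk', hcons]

/-- The probability that the next vertex is joined to `i`. -/
noncomputable def attachProb (α δ : ℝ) {n : ℕ} (g : SimpleGraph (Fin n)) (i : Fin n) : ℝ :=
  (1 / (δ + degree g i) ^ α) / ∑ j : Fin n, 1 / (δ + degree g j) ^ α

/-- The rate of the clock of the birth of an individual. -/
noncomputable def clockRate (α δ : ℝ) : List ℕ → ℝ
  -- The root has no clock; a positive default keeps the rate positive on all labels.
  | [] => 1
  | j :: _ => 1 / (((j + 1 : ℕ) : ℝ) + δ) ^ α

lemma IsBirthOrder.clockRate_childCount (hv : IsBirthOrder v n) (α δ : ℝ) (a : Fin n) :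
    clockRate α δ (childCount (firsts v n) (v a) :: v a)
      = 1 / (δ + degree (orderGraph v n) a) ^ α := by
  rw [hv.degree_eq, clockRate, add_comm δ]

/-- The probability of winning the race depends on the order of births only through the graph. This
makes the sequence of tree graphs follow the attachment rule even though a graph does not reveal the
labels. -/
lemma IsBirthOrder.attachProb_eq (hv : IsBirthOrder v n) (α δ : ℝ) (i : Fin n) :
    attachProb α δ (orderGraph v n) i
      = clockRate α δ (childCount (firsts v n) (v i) :: v i) /
        ∑ y ∈ frontier (firsts v n), clockRate α δ y := by
  rw [attachProb, Explored.sum_frontier, ← hv.clockRate_childCount]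
  congr 1
  conv_rhs => rw [firsts]
  rw [Finset.sum_image fun a ha b hb h => hv.injOn (by simpa using ha) (by simpa using hb) h,
    Finset.sum_range]
  refine Finset.sum_congr rfl fun a _ => (hv.clockRate_childCount α δ a).symm

end OrderGraph

/-! ### The law of a sequence of random graphs -/

instance (n : ℕ) : MeasurableSingletonClass (SimpleGraph (Fin n)) where
  measurableSet_singleton g := by
    have : ({g} : Set (SimpleGraph (Fin n))) = ⋂ a, ⋂ b, {h | h.Adj a b = g.Adj a b} := by
      ext h
      simp only [Set.mem_singleton_iff, Set.mem_iInter, Set.mem_ofPred_eq]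
      exact ⟨fun e a b => by rw [e], fun e => by ext a b; rw [e]⟩
    rw [this]
    refine .iInter fun a => .iInter fun b => ?_
    have hm : Measurable fun h : SimpleGraph (Fin n) => h.Adj a b :=
      (measurable_pi_apply b).comp ((measurable_pi_apply a).comp SimpleGraph.measurable_adj)
    exact hm (MeasurableSet.of_discrete (s := {g.Adj a b}))

section Law

variable {Ω Ω' : Type*} [MeasurableSpace Ω] [MeasurableSpace Ω'] {P : Measure Ω} {P' : Measure Ω'}
  {H : (n : ℕ) → Ω → SimpleGraph (Fin n)} {G : (n : ℕ) → Ω' → SimpleGraph (Fin n)}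

/-- The event that the graphs up to the `n`-th one are given by `g`. -/
def cylinder (H : (n : ℕ) → Ω → SimpleGraph (Fin n)) (n : ℕ) (g : (n : ℕ) → SimpleGraph (Fin n)) :
    Set Ω :=
  {ω | ∀ k ≤ n, H k ω = g k}

omit [MeasurableSpace Ω] in
lemma cylinder_succ (n : ℕ) (g : (n : ℕ) → SimpleGraph (Fin n)) :
    cylinder H (n + 1) g = cylinder H n g ∩ {ω | H (n + 1) ω = g (n + 1)} := by
  ext ω
  constructor
  · exact fun h => ⟨fun k hk => h k (hk.trans (Nat.le_succ n)), h (n + 1) le_rfl⟩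
  · rintro ⟨h1, h2⟩ k hk
    rcases Nat.le_succ_iff.1 hk with hk | rfl
    · exact h1 k hk
    · exact h2

lemma nullMeasurableSet_cylinder (hH : ∀ n, AEMeasurable (H n) P) (n : ℕ)
    (g : (n : ℕ) → SimpleGraph (Fin n)) : NullMeasurableSet (cylinder H n g) P := by
  have : cylinder H n g = ⋂ k, ⋂ (_ : k ≤ n), H k ⁻¹' {g k} := by
    ext ω; simp [cylinder]
  rw [this]
  exact .iInter fun k => .iInter fun _ => (hH k).nullMeasurable (measurableSet_singleton _)

/-- Graphs on `Fin n` form a finite type, so cylinders are the atoms of the law of an initial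
segment. Every finite set of indices lies in such a segment, and finite-dimensional marginals
determine the law. -/
lemma identDistrib_of_measure_cylinder [IsFiniteMeasure P] [IsFiniteMeasure P']
    (hG : ∀ n, AEMeasurable (G n) P') (hH : ∀ n, AEMeasurable (H n) P)
    (h : ∀ n g, P' (cylinder G n g) = P (cylinder H n g)) :
    IdentDistrib (fun ω n => G n ω) (fun ω n => H n ω) P' P := by
  have hG' : AEMeasurable (fun ω n => G n ω) P' := aemeasurable_pi_iff.2 hG
  have hH' : AEMeasurable (fun ω n => H n ω) P := aemeasurable_pi_iff.2 hH
  refine ⟨hG', hH', ?_⟩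
  have key : ∀ N : ℕ, (P'.map fun ω n => G n ω).map (Finset.Iic N).restrict
      = (P.map fun ω n => H n ω).map (Finset.Iic N).restrict := by
    intro N
    have hr : Measurable ((Finset.Iic N).restrict (π := fun n => SimpleGraph (Fin n))) :=
      Finset.measurable_restrict _
    refine Measure.ext_of_singleton fun a => ?_
    obtain ⟨g, rfl⟩ : ∃ g : (n : ℕ) → SimpleGraph (Fin n), (Finset.Iic N).restrict g = a :=
      ⟨fun n => if hn : n ∈ Finset.Iic N then a ⟨n, hn⟩ else ⊥, by
        ext1 n; simp only [Finset.restrict, Finset.coe_mem, dif_pos]⟩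
    have ha := hr (measurableSet_singleton ((Finset.Iic N).restrict g))
    rw [Measure.map_apply hr (measurableSet_singleton _),
      Measure.map_apply hr (measurableSet_singleton _), Measure.map_apply_of_aemeasurable hG' ha,
      Measure.map_apply_of_aemeasurable hH' ha]
    convert h N g using 2
    · ext ω
      simp [cylinder, funext_iff]
    · ext ω
      simp [cylinder, funext_iff]
  refine IsProjectiveLimit.unique (P := fun I => (P.map fun ω n => H n ω).map I.restrict)
    (fun I => ?_) fun I => rfl
  have hI : I ⊆ Finset.Iic (I.sup id) := fun i hi =>
    Finset.mem_Iic.2 (Finset.le_sup (f := id) hi)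
  have h1 := congrArg (Measure.map (Finset.restrict₂ (π := fun n => SimpleGraph (Fin n)) hI))
    (key (I.sup id))
  rw [Measure.map_map (Finset.measurable_restrict₂ _) (Finset.measurable_restrict _),
    Measure.map_map (Finset.measurable_restrict₂ _) (Finset.measurable_restrict _)] at h1
  exact h1

/-- The law of a sequence of random graphs that arises by attaching new vertices is determined by
the conditional probabilities of the choices. -/
lemma measure_cylinder_eq [IsProbabilityMeasure P] [IsProbabilityMeasure P']
    (hG : ∀ n, AEMeasurable (G n) P')
    {w : (n : ℕ) → SimpleGraph (Fin n) → Fin n → ℝ≥0∞}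
    (hGw : ∀ n, 1 ≤ n → ∀ g (i : Fin n),
      P' (cylinder G n g ∩ {ω | G (n + 1) ω = attach (g n) i}) = P' (cylinder G n g) * w n (g n) i)
    (hHw : ∀ n, 1 ≤ n → ∀ g (i : Fin n),
      P (cylinder H n g ∩ {ω | H (n + 1) ω = attach (g n) i}) = P (cylinder H n g) * w n (g n) i)
    (hHa : ∀ n, 1 ≤ n → ∀ᵐ ω ∂P, ∃ i, H (n + 1) ω = attach (H n ω) i)
    (n : ℕ) (g : (n : ℕ) → SimpleGraph (Fin n)) : P' (cylinder G n g) = P (cylinder H n g) := by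
  rcases Nat.eq_zero_or_pos n with rfl | hn
  · have h1 : cylinder G 0 g = Set.univ := by
      ext ω; simp only [cylinder, Set.mem_ofPred_eq, Set.mem_univ, iff_true]
      intro k hk; obtain rfl : k = 0 := by omega
      exact Subsingleton.elim _ _
    have h2 : cylinder H 0 g = Set.univ := by
      ext ω; simp only [cylinder, Set.mem_ofPred_eq, Set.mem_univ, iff_true]
      intro k hk; obtain rfl : k = 0 := by omega
      exact Subsingleton.elim _ _
    rw [h1, h2, measure_univ, measure_univ]
  induction n, hn using Nat.le_induction with
  | base =>
    have h1 : cylinder G 1 g = Set.univ := by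
      ext ω; simp only [cylinder, Set.mem_ofPred_eq, Set.mem_univ, iff_true]
      intro k hk
      rcases (by omega : k = 0 ∨ k = 1) with rfl | rfl <;> exact Subsingleton.elim _ _
    have h2 : cylinder H 1 g = Set.univ := by
      ext ω; simp only [cylinder, Set.mem_ofPred_eq, Set.mem_univ, iff_true]
      intro k hk
      rcases (by omega : k = 0 ∨ k = 1) with rfl | rfl <;> exact Subsingleton.elim _ _
    rw [h1, h2, measure_univ, measure_univ]
  | succ n hn ih =>
    by_cases hi : ∃ i, g (n + 1) = attach (g n) i
    · obtain ⟨i, hi⟩ := hi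
      rw [cylinder_succ, cylinder_succ, hi, hGw n hn, hHw n hn, ih]
    -- For `H` such a graph is excluded by `hHa`. For `G` it follows by counting: its attachments
    -- carry the same masses as those of `H`, and these exhaust the cylinder.
    · push Not at hi
      have zH : P (cylinder H (n + 1) g) = 0 := by
        refine measure_mono_null (t := {ω | ¬ ∃ i, H (n + 1) ω = attach (H n ω) i}) ?_
          (ae_iff.1 (hHa n hn))
        rintro ω hω ⟨i, hi'⟩
        rw [hω (n + 1) le_rfl, hω n (Nat.le_succ n)] at hi'
        exact hi i hi'
      have cover : P (cylinder H n g)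
          ≤ ∑ i, P (cylinder H n g ∩ {ω | H (n + 1) ω = attach (g n) i}) := by
        refine le_trans (measure_mono_ae ?_) (measure_iUnion_fintype_le _ _)
        filter_upwards [hHa n hn] with ω h1 h2
        obtain ⟨i, hi'⟩ := h1
        refine Set.mem_iUnion.2 ⟨i, h2, ?_⟩
        rw [h2 n le_rfl] at hi'
        exact hi'
      have disj : Pairwise (Function.onFun (AEDisjoint P')
          fun i => cylinder G n g ∩ {ω | G (n + 1) ω = attach (g n) i}) := by
        intro i i' hii
        refine Disjoint.aedisjoint (Set.disjoint_left.2 fun ω h1 h2 => hii ?_)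
        exact attach_injective (g n) (h1.2.symm.trans h2.2)
      have hnull : ∀ i, NullMeasurableSet
          (cylinder G n g ∩ {ω | G (n + 1) ω = attach (g n) i}) P' := fun i =>
        (nullMeasurableSet_cylinder hG n g).inter
          ((hG (n + 1)).nullMeasurable (measurableSet_singleton (attach (g n) i)))
      have hU : P' (⋃ i, cylinder G n g ∩ {ω | G (n + 1) ω = attach (g n) i})
          = ∑ i, P (cylinder H n g ∩ {ω | H (n + 1) ω = attach (g n) i}) := by
        rw [measure_iUnion₀ disj hnull, tsum_fintype]
        refine Finset.sum_congr rfl fun i _ => ?_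
        rw [hGw n hn, hHw n hn, ih]
      have hsub : (⋃ i, cylinder G n g ∩ {ω | G (n + 1) ω = attach (g n) i}) ⊆ cylinder G n g :=
        Set.iUnion_subset fun i => Set.inter_subset_left
      have hd : P' (cylinder G n g \ ⋃ i, cylinder G n g ∩ {ω | G (n + 1) ω = attach (g n) i})
          = 0 := by
        rw [measure_sdiff hsub (.iUnion hnull) (measure_ne_top _ _), hU, ih]
        exact tsub_eq_zero_of_le cover
      rw [zH]
      refine measure_mono_null ?_ hd
      rw [cylinder_succ]
      rintro ω ⟨h1, h2⟩
      refine ⟨h1, fun h3 => ?_⟩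
      obtain ⟨i, -, h4⟩ := Set.mem_iUnion.1 h3
      exact hi i (h2.symm.trans h4)

/-- The cylinder belongs to the history, and the conditional probability is constant on it, so
integrating over it gives the product. -/
lemma IsInverseDePreferential.measure_cylinder_inter [IsFiniteMeasure P'] {α δ : ℝ}
    (hG : IsInverseDePreferential P' α δ G) (n : ℕ) (g : (n : ℕ) → SimpleGraph (Fin n))
    (i : Fin n) :
    P' (cylinder G n g ∩ {ω | G (n + 1) ω = attach (g n) i})
      = P' (cylinder G n g) * ENNReal.ofReal (attachProb α δ (g n) i) := by
  have hle : graphHistory G n ≤ ‹MeasurableSpace Ω'› :=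
    iSup₂_le fun k _ => (hG.measurable k).comap_le
  have hC : MeasurableSet[graphHistory G n] (cylinder G n g) := by
    have : cylinder G n g = ⋂ k, ⋂ (_ : k ≤ n), G k ⁻¹' {g k} := by
      ext ω; simp [cylinder]
    rw [this]
    refine @MeasurableSet.iInter _ _ (graphHistory G n) _ _ fun k =>
      @MeasurableSet.iInter _ _ (graphHistory G n) _ _ fun hk => ?_
    exact (le_iSup₂ (f := fun k (_ : k ≤ n) => MeasurableSpace.comap (G k) inferInstance) k hk) _
      ⟨_, measurableSet_singleton (g k), rfl⟩
  have hT : MeasurableSet {ω | G (n + 1) ω = attach (G n ω) i} := by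
    have : Measurable fun ω => (G (n + 1) ω, G n ω) :=
      (hG.measurable (n + 1)).prodMk (hG.measurable n)
    exact this (MeasurableSet.of_discrete (s := {q | q.1 = attach q.2 i}))
  have h1 := setIntegral_condExp hle (f := Set.indicator {ω | G (n + 1) ω = attach (G n ω) i}
    fun _ => (1 : ℝ)) (μ := P') ((integrable_const 1).indicator hT) hC
  have h2 : ∫ ω in cylinder G n g, (P'⟦{ω | G (n + 1) ω = attach (G n ω) i} | graphHistory G n⟧) ω
      ∂P' = ∫ ω in cylinder G n g, attachProb α δ (g n) i ∂P' := by
    refine setIntegral_congr_ae (hle _ hC) ?_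
    filter_upwards [hG.step n i] with ω hω hωC
    rw [hω, hωC n le_rfl]
    rfl
  rw [h2, setIntegral_const, setIntegral_indicator hT, setIntegral_const, smul_eq_mul, smul_eq_mul,
    mul_one] at h1
  have h3 : cylinder G n g ∩ {ω | G (n + 1) ω = attach (G n ω) i}
      = cylinder G n g ∩ {ω | G (n + 1) ω = attach (g n) i} := by
    ext ω
    refine and_congr_right fun h => ?_
    have : G n ω = g n := h n le_rfl
    simp only [Set.mem_ofPred_eq, this]
  rw [h3] at h1
  rw [← ofReal_measureReal (s := cylinder G n g ∩ _), ← h1, ENNReal.ofReal_mul measureReal_nonneg,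
    ofReal_measureReal]

end Law

/-! ### The order of births is almost surely realized -/

section Orders

variable {v : ℕ → List ℕ} {n : ℕ}

lemma firsts_update (v : ℕ → List ℕ) (n : ℕ) (z : List ℕ) {k : ℕ} (hk : k ≤ n) :
    firsts (Function.update v n z) k = firsts v k :=
  firsts_congr fun i hi => Function.update_of_ne (by omega) _ _

lemma IsBirthOrder.update (hv : IsBirthOrder v n) (hn : 1 ≤ n) {z : List ℕ}
    (hz : z ∈ frontier (firsts v n)) : IsBirthOrder (Function.update v n z) (n + 1) := by
  refine ⟨by rw [Function.update_of_ne (by omega), hv.zero], fun k h1 h2 => ?_⟩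
  rw [firsts_update v n z (by omega)]
  rcases Nat.lt_succ_iff_lt_or_eq.1 h2 with h | rfl
  · rw [Function.update_of_ne h.ne]
    exact hv.mem_frontier k h1 h
  · rwa [Function.update_self]

/-- At the first disagreement, each of the two candidates would be born strictly before the other.
-/
lemma Realizes.unique {e : List ℕ → ℝ} {w : ℕ → List ℕ} (hv : IsBirthOrder v n)
    (hw : IsBirthOrder w n) (h : Realizes e v n) (h' : Realizes e w n) : ∀ k < n, v k = w k := by
  intro k
  induction k using Nat.strong_induction_on with
  | _ k ih =>
    intro hk
    rcases Nat.eq_zero_or_pos k with rfl | h1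
    · rw [hv.zero, hw.zero]
    · have e1 : firsts v k = firsts w k := firsts_congr fun i hi => ih i hi (hi.trans hk)
      by_contra hne
      have h2 := h k h1 hk (w k) (e1 ▸ hw.mem_frontier k h1 hk) (Ne.symm hne)
      have h3 := h' k h1 hk (v k) (e1 ▸ hv.mem_frontier k h1 hk) hne
      exact lt_asymm h2 h3

/-- Extension of a finite sequence by the root. -/
def extendRoot (u : Fin n → List ℕ) (k : ℕ) : List ℕ := if h : k < n then u ⟨k, h⟩ else []

lemma extendRoot_restrict (v : ℕ → List ℕ) (n : ℕ) {k : ℕ} (hk : k < n) :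
    v k = extendRoot (fun a : Fin n => v a) k := by
  simp [extendRoot, hk]

lemma extendRoot_val (u : Fin n → List ℕ) (a : Fin n) : extendRoot u a = u a := by
  simp [extendRoot]

variable {Ω : Type*} [MeasurableSpace Ω] {P : Measure Ω} [IsProbabilityMeasure P]
  {r : List ℕ → ℝ} {E : List ℕ → Ω → ℝ}

/-- The continuations are disjoint and their winning probabilities add up to `1`, so a tie for the
next birth has probability zero. -/
lemma IndepExp.ae_exists_update (h : IndepExp P {y | y ≠ []} r E)
    (hE : ∀ y, Measurable (E y)) (hr : ∀ y, y ≠ [] → 0 < r y) (hn : 1 ≤ n)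
    (hv : IsBirthOrder v n) :
    ∀ᵐ ω ∂P, Realizes (E · ω) v n →
      ∃ z ∈ frontier (firsts v n), Realizes (E · ω) (Function.update v n z) (n + 1) := by
  have hF := hv.explored hn
  have hpos : ∀ z ∈ frontier (firsts v n), 0 < r z := fun z hz => hr z (hF.mem_frontier.1 hz).2.1
  have hR : 0 < ∑ y ∈ frontier (firsts v n), r y := Finset.sum_pos hpos hF.frontier_nonempty
  have e1 : P (⋃ z ∈ frontier (firsts v n),
      {ω | Realizes (E · ω) (Function.update v n z) (n + 1)}) = P {ω | Realizes (E · ω) v n} := by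
    rw [measure_biUnion_finset _ fun z _ => measurableSet_realizes hE _ _]
    · have : ∀ z ∈ frontier (firsts v n),
          P {ω | Realizes (E · ω) (Function.update v n z) (n + 1)} =
            P {ω | Realizes (E · ω) v n} *
              ENNReal.ofReal (r z / ∑ y ∈ frontier (firsts v n), r y) := by
        intro z hz
        rw [h.measure_realizes_succ hE hr hn (hv.update hn hz), firsts_update v n z le_rfl,
          Function.update_self]
        congr 2
        ext ω
        exact ⟨fun h => h.congr fun k hk => Function.update_of_ne hk.ne _ _,
          fun h => h.congr fun k hk => (Function.update_of_ne hk.ne _ _).symm⟩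
      rw [Finset.sum_congr rfl this, ← Finset.mul_sum,
        ← ENNReal.ofReal_sum_of_nonneg fun z hz => (div_pos (hpos z hz) hR).le, ← Finset.sum_div,
        div_self hR.ne', ENNReal.ofReal_one, mul_one]
    · intro z hz z' hz' hne
      refine Set.disjoint_left.2 fun ω h1 h2 => hne ?_
      have := Realizes.unique (hv.update hn hz) (hv.update hn hz') h1 h2 n (Nat.lt_succ_self n)
      rwa [Function.update_self, Function.update_self] at this
  have hsub : (⋃ z ∈ frontier (firsts v n),
      {ω | Realizes (E · ω) (Function.update v n z) (n + 1)}) ⊆ {ω | Realizes (E · ω) v n} := by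
    refine Set.iUnion₂_subset fun z _ ω hω => ?_
    exact Realizes.congr (Realizes.mono hω (Nat.le_succ n))
      fun k hk => Function.update_of_ne hk.ne _ _
  have hd := measure_sdiff (μ := P) hsub (Finset.measurableSet_biUnion _ fun z _ =>
    measurableSet_realizes hE (Function.update v n z) (n + 1)).nullMeasurableSet
    (measure_ne_top _ _)
  rw [e1, tsub_self] at hd
  rw [ae_iff]
  refine measure_mono_null (fun ω hω => ?_) hd
  simp only [Set.mem_ofPred_eq, not_forall] at hω
  obtain ⟨h1, h2⟩ := hω
  refine ⟨h1, fun h3 => h2 ?_⟩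
  simpa using h3

lemma IndepExp.ae_exists_realizes (h : IndepExp P {y | y ≠ []} r E)
    (hE : ∀ y, Measurable (E y)) (hr : ∀ y, y ≠ [] → 0 < r y) (hn : 1 ≤ n) :
    ∀ᵐ ω ∂P, ∃ v, IsBirthOrder v n ∧ Realizes (E · ω) v n := by
  induction n, hn using Nat.le_induction with
  | base =>
    refine ae_of_all _ fun ω => ⟨fun _ => [], ⟨rfl, fun k h1 h2 => ?_⟩, fun k h1 h2 => ?_⟩ <;> omega
  | succ n hn ih =>
    -- Only the first `n` terms of an order matter, and `Fin n → List ℕ` is countable, unlike `ℕ →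
    -- List ℕ`; this allows the quantifier inside the almost sure statement.
    have hall : ∀ᵐ ω ∂P, ∀ u : Fin n → List ℕ, IsBirthOrder (extendRoot u) n →
        Realizes (E · ω) (extendRoot u) n → ∃ z ∈ frontier (firsts (extendRoot u) n),
          Realizes (E · ω) (Function.update (extendRoot u) n z) (n + 1) := by
      refine ae_all_iff.2 fun u => ?_
      by_cases hu : IsBirthOrder (extendRoot u) n
      · filter_upwards [h.ae_exists_update hE hr hn hu] with ω hω _ using hω
      · exact ae_of_all _ fun ω hu' => absurd hu' hu
    filter_upwards [ih, hall] with ω ⟨v, hv, hvr⟩ hω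
    have hu := hv.congr hn fun k hk => extendRoot_restrict v n hk
    obtain ⟨z, hz, hzr⟩ := hω _ hu (hvr.congr fun k hk => extendRoot_restrict v n hk)
    exact ⟨_, hu.update hn hz, hzr⟩

/-- An event that is determined by the order of the first `n` births. -/
lemma IndepExp.ae_eq_iUnion_realizes (h : IndepExp P {y | y ≠ []} r E)
    (hE : ∀ y, Measurable (E y)) (hr : ∀ y, y ≠ [] → 0 < r y) (hn : 1 ≤ n) {S : Set Ω}
    {D : (Fin n → List ℕ) → Prop}
    (hS : ∀ᵐ ω ∂P, ∀ u : Fin n → List ℕ, IsBirthOrder (extendRoot u) n →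
      Realizes (E · ω) (extendRoot u) n → (ω ∈ S ↔ D u)) :
    (S : Set Ω) =ᵐ[P] (⋃ u : {u : Fin n → List ℕ // IsBirthOrder (extendRoot u) n ∧ D u},
      {ω | Realizes (E · ω) (extendRoot u.1) n} : Set Ω) := by
  refine eventuallyEq_set.2 ?_
  filter_upwards [hS, h.ae_exists_realizes hE hr hn] with ω hω ⟨v, hv, hvr⟩
  rw [Set.mem_iUnion]
  constructor
  · intro hωS
    have hu := hv.congr hn fun k hk => extendRoot_restrict v n hk
    have hur := hvr.congr fun k hk => extendRoot_restrict v n hk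
    exact ⟨⟨_, hu, (hω _ hu hur).1 hωS⟩, hur⟩
  · rintro ⟨⟨u, hu, hD⟩, hur⟩
    exact (hω u hu hur).2 hD

end Orders

/-! ### The one-step law of the tree graphs -/

section Tree

variable {Ω : Type*} [MeasurableSpace Ω] {P : Measure Ω} [IsProbabilityMeasure P] {α δ : ℝ}
  {X : Ω → List ℕ → ℝ≥0 → ℕ}

lemma clockRate_pos (α : ℝ) (hδ : -1 < δ) (y : List ℕ) : 0 < clockRate α δ y := by
  match y with
  | [] => exact one_pos
  | j :: x =>
    have : (0 : ℝ) < ((j + 1 : ℕ) : ℝ) + δ := by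
      push_cast
      have : (0 : ℝ) ≤ j := Nat.cast_nonneg j
      linarith
    exact one_div_pos.2 (Real.rpow_pos_of_pos this α)

lemma IsRegularFamily.treeGraph_eq {Y : List ℕ → ℝ≥0 → ℕ} (hY : IsRegularFamily Y)
    {v : ℕ → List ℕ} {n k : ℕ} (hv : IsBirthOrder v n) (h : Realizes (birthClock Y) v n)
    (hk : k ≤ n) : treeGraph Y k = orderGraph v k := by
  rcases Nat.eq_zero_or_pos k with rfl | h1
  · exact Subsingleton.elim _ _
  · exact ((hY.bornFirst hv h).mono hk).treeGraph_eq (hv.mono hk) h1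

/-- The definition involves infima over uncountably many times. Measurability comes from almost sure
equality with a countable union of realization events. -/
lemma aemeasurable_treeGraph (hX : ∀ᵐ ω ∂P, IsRegularFamily (X ω)) (hδ : -1 < δ)
    (hE : ∀ y, Measurable fun ω => birthClock (X ω) y)
    (h : IndepExp P {y | y ≠ []} (clockRate α δ) fun y ω => birthClock (X ω) y) (n : ℕ) :
    AEMeasurable (fun ω => treeGraph (X ω) n) P := by
  rcases Nat.eq_zero_or_pos n with rfl | hn
  · have : (fun ω => treeGraph (X ω) 0) = fun _ => ⊥ := funext fun ω => Subsingleton.elim _ _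
    rw [this]
    exact aemeasurable_const
  refine NullMeasurable.aemeasurable fun s _ => ?_
  have := h.ae_eq_iUnion_realizes hE (fun y _ => clockRate_pos α hδ y) hn
    (S := (fun ω => treeGraph (X ω) n) ⁻¹' s) (D := fun u => orderGraph (extendRoot u) n ∈ s) (by
      filter_upwards [hX] with ω hω u hu hur
      rw [Set.mem_preimage, hω.treeGraph_eq hu hur le_rfl])
  exact (MeasurableSet.iUnion fun u => measurableSet_realizes hE _ _).nullMeasurableSet.congr
    this.symm

/-- The cylinder splits into the countably many birth orders that produce the graphs `g`. For each
of them, attaching to `i` means that the next child of the `i`-th individual is born next, and the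
conditional probability of this is the same for all these orders. -/
lemma measure_cylinder_treeGraph_inter (hX : ∀ᵐ ω ∂P, IsRegularFamily (X ω)) (hδ : -1 < δ)
    (hE : ∀ y, Measurable fun ω => birthClock (X ω) y)
    (h : IndepExp P {y | y ≠ []} (clockRate α δ) fun y ω => birthClock (X ω) y) {n : ℕ}
    (hn : 1 ≤ n) (g : (n : ℕ) → SimpleGraph (Fin n)) (i : Fin n) :
    P (cylinder (fun n ω => treeGraph (X ω) n) n g ∩
        {ω | treeGraph (X ω) (n + 1) = attach (g n) i})
      = P (cylinder (fun n ω => treeGraph (X ω) n) n g) *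
        ENNReal.ofReal (attachProb α δ (g n) i) := by
  have hr : ∀ y, y ≠ [] → 0 < clockRate α δ y := fun y _ => clockRate_pos α hδ y
  let D : (Fin n → List ℕ) → Prop := fun u => ∀ k ≤ n, orderGraph (extendRoot u) k = g k
  let next : (Fin n → List ℕ) → List ℕ := fun u =>
    childCount (firsts (extendRoot u) n) (extendRoot u i) :: extendRoot u i
  have hnext : ∀ u, next u ∈ frontier (firsts (extendRoot u) n) := fun u =>
    Finset.mem_image_of_mem _ (mem_firsts.2 ⟨i, i.2, rfl⟩)
  have hD : ∀ᵐ ω ∂P, ∀ u : Fin n → List ℕ, IsBirthOrder (extendRoot u) n →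
      Realizes (birthClock (X ω) ·) (extendRoot u) n →
        (ω ∈ cylinder (fun n ω => treeGraph (X ω) n) n g ↔ D u) := by
    filter_upwards [hX] with ω hω u hu hur
    exact forall₂_congr fun k hk => by simp only [hω.treeGraph_eq hu hur hk]
  have e1 := h.ae_eq_iUnion_realizes hE hr hn hD
  have e2 : (cylinder (fun n ω => treeGraph (X ω) n) n g ∩
      {ω | treeGraph (X ω) (n + 1) = attach (g n) i} : Set Ω) =ᵐ[P]
      (⋃ u : {u : Fin n → List ℕ // IsBirthOrder (extendRoot u) n ∧ D u},
        {ω | Realizes (birthClock (X ω) ·) (Function.update (extendRoot u.1) n (next u.1)) (n + 1)}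
        : Set Ω) := by
    refine eventuallyEq_set.2 ?_
    filter_upwards [hX, hD, h.ae_exists_realizes hE hr (Nat.le_add_left 1 n)]
      with ω hω hDω ⟨v, hv, hvr⟩
    rw [Set.mem_iUnion, Set.mem_inter_iff]
    constructor
    · rintro ⟨h1, h2⟩
      have hv' := hv.mono (Nat.le_succ n)
      have hvu : ∀ k < n, v k = extendRoot (fun a : Fin n => v a) k := fun k hk =>
        extendRoot_restrict v n hk
      have hu := hv'.congr hn hvu
      have hur := (hvr.mono (Nat.le_succ n)).congr hvu
      have hDu := (hDω _ hu hur).1 h1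
      refine ⟨⟨_, hu, hDu⟩, ?_⟩
      have hfront := hv.mem_frontier n hn (Nat.lt_succ_self n)
      obtain ⟨x, hx, hxv⟩ := Finset.mem_image.1 hfront
      obtain ⟨k, hk, rfl⟩ := mem_firsts.1 hx
      have h2 : treeGraph (X ω) (n + 1) = attach (g n) i := h2
      rw [hω.treeGraph_eq hv hvr le_rfl, hv.orderGraph_succ hn (i := ⟨k, hk⟩) ⟨_, hxv.symm⟩,
        orderGraph_congr hvu, hDu n le_rfl] at h2
      -- The graph reveals the parent of the newcomer, hence also its label.
      have hki := attach_injective _ h2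
      subst hki
      refine hvr.congr fun l hl => ?_
      rcases Nat.lt_succ_iff_lt_or_eq.1 hl with hl | rfl
      · rw [Function.update_of_ne hl.ne, hvu l hl]
      · rw [Function.update_self]
        simp only [next]
        rw [← firsts_congr hvu, ← hvu k hk]
        exact hxv.symm
    · rintro ⟨⟨u, hu, hDu⟩, hur⟩
      have hu' := hu.update hn (hnext u)
      have hup : ∀ k < n, Function.update (extendRoot u) n (next u) k = extendRoot u k :=
        fun k hk => Function.update_of_ne hk.ne _ _
      refine ⟨(hDω u hu ((Realizes.mono hur (Nat.le_succ n)).congr hup)).2 hDu, ?_⟩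
      change treeGraph (X ω) (n + 1) = attach (g n) i
      rw [hω.treeGraph_eq hu' hur le_rfl, hu'.orderGraph_succ hn (i := i), orderGraph_congr hup,
        hDu n le_rfl]
      rw [Function.update_self, hup i i.2]
      exact ⟨_, rfl⟩
  have key : ∀ u : {u : Fin n → List ℕ // IsBirthOrder (extendRoot u) n ∧ D u},
      P {ω | Realizes (birthClock (X ω) ·) (Function.update (extendRoot u.1) n (next u.1)) (n + 1)}
        = P {ω | Realizes (birthClock (X ω) ·) (extendRoot u.1) n} *
          ENNReal.ofReal (attachProb α δ (g n) i) := by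
    rintro ⟨u, hu, hDu⟩
    rw [h.measure_realizes_succ hE hr hn (hu.update hn (hnext u)), firsts_update _ n _ le_rfl,
      Function.update_self, ← hDu n le_rfl, hu.attachProb_eq]
    congr 2
    ext ω
    exact ⟨fun h => h.congr fun k hk => Function.update_of_ne hk.ne _ _,
      fun h => h.congr fun k hk => (Function.update_of_ne hk.ne _ _).symm⟩
  have disj : ∀ (ω : Ω) (u u' : {u : Fin n → List ℕ // IsBirthOrder (extendRoot u) n ∧ D u}),
      Realizes (birthClock (X ω) ·) (extendRoot u.1) n →
      Realizes (birthClock (X ω) ·) (extendRoot u'.1) n → u = u' := by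
    intro ω u u' h1 h2
    refine Subtype.ext (funext fun a => ?_)
    rw [← extendRoot_val u.1 a, ← extendRoot_val u'.1 a]
    exact Realizes.unique u.2.1 u'.2.1 h1 h2 a a.2
  rw [measure_congr e1, measure_congr e2, measure_iUnion, measure_iUnion, ← ENNReal.tsum_mul_right]
  · exact tsum_congr key
  · exact fun u u' hne => Set.disjoint_left.2 fun ω h1 h2 => hne (disj ω u u' h1 h2)
  · exact fun u => measurableSet_realizes hE _ _
  · intro u u' hne
    refine Set.disjoint_left.2 fun ω h1 h2 => hne (disj ω u u' ?_ ?_)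
    · exact Realizes.congr (Realizes.mono h1 (Nat.le_succ n))
        fun k hk => Function.update_of_ne hk.ne _ _
    · exact Realizes.congr (Realizes.mono h2 (Nat.le_succ n))
        fun k hk => Function.update_of_ne hk.ne _ _
  · exact fun u => measurableSet_realizes hE _ _

lemma ae_exists_treeGraph_succ (hX : ∀ᵐ ω ∂P, IsRegularFamily (X ω)) (hδ : -1 < δ)
    (hE : ∀ y, Measurable fun ω => birthClock (X ω) y)
    (h : IndepExp P {y | y ≠ []} (clockRate α δ) fun y ω => birthClock (X ω) y) {n : ℕ}
    (hn : 1 ≤ n) : ∀ᵐ ω ∂P, ∃ i, treeGraph (X ω) (n + 1) = attach (treeGraph (X ω) n) i := by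
  filter_upwards [hX, h.ae_exists_realizes hE (fun y _ => clockRate_pos α hδ y)
    (Nat.le_add_left 1 n)] with ω hω ⟨v, hv, hvr⟩
  obtain ⟨x, hx, hxv⟩ := Finset.mem_image.1 (hv.mem_frontier n hn (Nat.lt_succ_self n))
  obtain ⟨k, hk, rfl⟩ := mem_firsts.1 hx
  refine ⟨⟨k, hk⟩, ?_⟩
  rw [hω.treeGraph_eq hv hvr le_rfl, hω.treeGraph_eq hv hvr (Nat.le_succ n)]
  exact hv.orderGraph_succ hn ⟨_, hxv.symm⟩

end Tree

/-! ### Independence of the birth clocks -/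

section Family

variable {Ω : Type*} [MeasurableSpace Ω] {P : Measure Ω} [IsProbabilityMeasure P] {α δ : ℝ}
  {ξ : List ℕ → ℝ≥0 → Ω → ℕ}

lemma birthRate_pos (α : ℝ) (hδ : -1 < δ) (k : ℕ) (hk : 1 ≤ k) :
    0 < 1 / ((k : ℝ) + δ) ^ α := by
  have : (1 : ℝ) ≤ k := by exact_mod_cast hk
  exact one_div_pos.2 (Real.rpow_pos_of_pos (by linarith) α)

lemma ae_isRegularFamily (hδ : -1 < δ)
    (hξ : ∀ x, IsPureBirthProcess P 1 (fun k => 1 / ((k : ℝ) + δ) ^ α) (ξ x)) :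
    ∀ᵐ ω ∂P, IsRegularFamily fun x t => ξ x t ω := by
  filter_upwards [ae_all_iff.2 fun x => (hξ x).ae_isCountingPath,
    ae_all_iff.2 fun x => (hξ x).ae_reachTime (birthRate_pos α hδ)] with ω h1 h2
  exact ⟨h1, fun x k => (h2 x k).1, fun x k => (h2 x k).2⟩

lemma measurable_holdTime_path (hξ : ∀ x t, Measurable (ξ x t)) (x : List ℕ) (j : ℕ) :
    Measurable fun ω => holdTime (fun t => ξ x t ω) j :=
  (measurable_holdTime j).comp (measurable_pi_iff.2 (hξ x))

lemma measurable_birthClock (hξ : ∀ x t, Measurable (ξ x t)) (y : List ℕ) :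
    Measurable fun ω => birthClock (fun x t => ξ x t ω) y := by
  match y with
  | [] => exact measurable_const
  | j :: x => exact measurable_holdTime_path hξ x j

/-- The clocks of the births are independent and exponential. -/
lemma indepExp_birthClock (hδ : -1 < δ)
    (hξ : ∀ x, IsPureBirthProcess P 1 (fun k => 1 / ((k : ℝ) + δ) ^ α) (ξ x))
    (hindep : iIndepFun (fun (x : List ℕ) (ω : Ω) (t : ℝ≥0) => ξ x t ω) P) :
    IndepExp P {y | y ≠ []} (clockRate α δ) fun y ω => birthClock (fun x t => ξ x t ω) y := by
  have hm := measurable_holdTime_path fun x => (hξ x).measurable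
  -- Independence between individuals and independence of the holding times within each individual
  -- combine into joint independence over all pairs.
  have hall : iIndepFun (fun (p : List ℕ × ℕ) ω => holdTime (fun t => ξ p.1 t ω) p.2) P :=
    iIndepFun_uncurry' hm
      (hindep.comp (fun _ f j => holdTime f j) fun _ => measurable_pi_iff.2 measurable_holdTime)
      fun x => (hξ x).iIndepFun_holdTime (birthRate_pos α hδ)
  rw [iIndepFun_iff_measure_inter_preimage_eq_mul] at hall
  intro S hS B hB
  have hcons : ∀ y ∈ S, y.headI :: y.tail = y := fun y hy => by
    match y, hS hy with
    | j :: x, _ => rfl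
  have hinj : Set.InjOn (fun y : List ℕ => (y.tail, y.headI)) S := by
    intro y hy z hz h
    rw [← hcons y hy, ← hcons z hz, (Prod.mk.inj h).1, (Prod.mk.inj h).2]
  have h1 := hall (S.image fun y => (y.tail, y.headI)) (sets := fun p => B (p.2 :: p.1))
    fun p _ => hB _
  rw [Finset.prod_image hinj, Finset.set_biInter_finset_image] at h1
  have h2 : ∀ y ∈ S, (fun ω => holdTime (fun t => ξ y.tail t ω) y.headI) ⁻¹' B (y.headI :: y.tail)
      = (fun ω => birthClock (fun x t => ξ x t ω) y) ⁻¹' B y := fun y hy => by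
    match y, hS hy with
    | j :: x, _ => rfl
  rw [Set.iInter₂_congr h2] at h1
  rw [h1]
  refine Finset.prod_congr rfl fun y hy => ?_
  match y, hS hy with
  | j :: x, _ =>
    have := (hξ x).map_holdTime (birthRate_pos α hδ) j
    rw [clockRate, ← this, Measure.map_apply (hm x j) (hB _)]
    rfl

end Family

end DePref

theorem theorem4p1 {Ω Ω' : Type*} [MeasurableSpace Ω] [MeasurableSpace Ω']
    (P : Measure Ω) [IsProbabilityMeasure P] (P' : Measure Ω') [IsProbabilityMeasure P']
    (α δ : ℝ) (hα : 0 < α) (hδ : -1 < δ)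
    (G : (n : ℕ) → Ω' → SimpleGraph (Fin n))
    (hG : DePref.IsInverseDePreferential P' α δ G)
    (ξ : List ℕ → ℝ≥0 → Ω → ℕ)
    (hξ : ∀ x, DePref.IsPureBirthProcess P 1 (fun k => 1 / ((k : ℝ) + δ) ^ α) (ξ x))
    (hindep : iIndepFun (fun (x : List ℕ) (ω : Ω) (t : ℝ≥0) => ξ x t ω) P) :
    (∀ᵐ ω ∂P, ∀ n : ℕ, 2 ≤ n →
      DePref.hittingTime (fun x t => ξ x t ω) n < ∞ ∧
      (DePref.tree (fun x t => ξ x t ω)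
        (DePref.hittingTime (fun x t => ξ x t ω) n)).encard = (n : ℕ∞) ∧
      Set.InjOn (DePref.birthTime fun x t => ξ x t ω)
        (DePref.tree (fun x t => ξ x t ω)
          (DePref.hittingTime (fun x t => ξ x t ω) n))) ∧
    IdentDistrib
      (fun (ω : Ω') (n : {n : ℕ // 2 ≤ n}) => G n ω)
      (fun (ω : Ω) (n : {n : ℕ // 2 ≤ n}) => DePref.treeGraph (fun x t => ξ x t ω) n)
      P' P
:= by
  have hreg := DePref.ae_isRegularFamily hδ hξ
  have hE := DePref.measurable_birthClock fun x => (hξ x).measurable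
  have hind := DePref.indepExp_birthClock hδ hξ hindep
  constructor
  · refine ae_all_iff.2 fun n => ?_
    by_cases hn : 1 ≤ n
    · filter_upwards [hreg, hind.ae_exists_realizes hE
        (fun y _ => DePref.clockRate_pos α hδ y) hn] with ω hω ⟨v, hv, hvr⟩ _
      have hb := hω.bornFirst hv hvr
      have ht := hb.tree_eq hv hn
      refine ⟨?_, ?_, ?_⟩
      · obtain ⟨m, rfl⟩ := Nat.exists_eq_add_of_le' hn
        rw [hb.hittingTime_eq hv]
        exact hb.lt_top (Nat.lt_succ_self m)
      · rw [ht, Set.encard_coe_eq_coe_finsetCard, hv.card_firsts le_rfl]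
      · rw [ht]
        exact hb.injOn hv
    · exact ae_of_all _ fun ω h2 => absurd (one_le_two.trans h2) hn
  · have hGm : ∀ n, AEMeasurable (G n) P' := fun n => (hG.measurable n).aemeasurable
    have hid := DePref.identDistrib_of_measure_cylinder hGm
      (DePref.aemeasurable_treeGraph hreg hδ hE hind)
      (DePref.measure_cylinder_eq hGm
        (w := fun _ g i => ENNReal.ofReal (DePref.attachProb α δ g i)) (fun n _ g i => hG.measure_cylinder_inter n g i)
        (fun n hn g i => DePref.measure_cylinder_treeGraph_inter hreg hδ hE hind hn g i)
        (fun n hn => DePref.ae_exists_treeGraph_succ hreg hδ hE hind hn))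
    -- Equality in law holds for the sequences over all `n`; restriction to `n ≥ 2` is a measurable
    -- map.
    exact hid.comp (u := fun f (n : {n : ℕ // 2 ≤ n}) => f n)
      (measurable_pi_iff.2 fun n => measurable_pi_apply _)
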